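/- An instance of fair allocation of conflicting items consists of $n$ agents, $m$ items, an additive valuation $v_i(S)=\sum_{j\in S}v_{ij}$ with rational $v_{ij}\ge 0$ for each agent $i$, and a conflict graph $G$ whose vertices are the items. A feasible allocation $A=\langle A_1,\dots,A_n\rangle$ is a partition of all items into $n$ (possibly empty) bundles, each of which is an independent set of $G$. The maximin share of agent $i$ is $\mu_i=\max_A\min_k v_i(A_k)$, the maximum being over all feasible allocations, and a feasible allocation $A$ is $\tfrac18$-approximate MMS if $v_i(A_i)\ge\tfrac18\mu_i$ for every agent $i$. Let $\mathcal C$ be a class of finite graphs such that the maximum weighted independent set problem, with nonnegative rational vertex weights, can be solved in polynomial time on all graphs in $\mathcal C$ and all their induced subgraphs. Then there is a polynomial-time algorithm that, given any instance whose conflict graph $G$ lies in $\mathcal C$ and whose number of agents satisfies $n>\Delta(G)$, where $\Delta(G)$ is the maximum degree of $G$, finds a $\tfrac18$-approximate MMS allocation of the instance. (Running times are measured in the size of the input, with rational numbers given by numerator and denominator in binary.) -/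

import Mathlib

open scoped NNRat

noncomputable section

/-! ### A machine model with a step count

Programs of a structured WHILE language work on binary trees. Every primitive operation, every
test and every duplication of data is charged the full size of the tree that it reads or copies,
so a run of cost `t` never holds data of size more than `t`, and the model simulates and is
simulated by multi-tape Turing machines with polynomial overhead. -/

/-- Finite binary trees, the data of the programs. -/
inductive Data : Type
  | nil : Data
  | cons : Data → Data → Data

namespace Data

/-- Number of nodes. -/
def size : Data → ℕ
  | nil => 1
  | cons a b => a.size + b.size + 1

def head : Data → Data
  | nil => nil
  | cons a _ => a

def tail : Data → Data
  | nil => nil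
  | cons _ b => b

end Data

/-- Programs; each one transforms a single tree. In tests, `nil` means false and every other tree
means true. -/
inductive Prog : Type
  | id : Prog
  | nil : Prog
  | head : Prog
  | tail : Prog
  /-- run both programs on the input and join the two results by `cons` -/
  | pair : Prog → Prog → Prog
  /-- `seq f g` runs `f` first, then `g` on the result -/
  | seq : Prog → Prog → Prog
  /-- `cond c f g`: if `c` then `f` else `g` -/
  | cond : Prog → Prog → Prog → Prog
  /-- `loop c f`: while `c` do `f` -/
  | loop : Prog → Prog → Prog

/-- `Prog.Eval p x y t`: on input `x`, the program `p` halts with output `y` after `t` steps. -/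
inductive Prog.Eval : Prog → Data → Data → ℕ → Prop
  | id (x : Data) : Prog.Eval .id x x x.size
  | nil (x : Data) : Prog.Eval .nil x .nil x.size
  | head (x : Data) : Prog.Eval .head x x.head x.size
  | tail (x : Data) : Prog.Eval .tail x x.tail x.size
  | pair {f g : Prog} {x y z : Data} {s t : ℕ} :
      Prog.Eval f x y s → Prog.Eval g x z t →
      Prog.Eval (.pair f g) x (.cons y z) (s + t + x.size)
  | seq {f g : Prog} {x y z : Data} {s t : ℕ} :
      Prog.Eval f x y s → Prog.Eval g y z t → Prog.Eval (.seq f g) x z (s + t)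
  | cond_true {c f g : Prog} {x a b y : Data} {s t : ℕ} :
      Prog.Eval c x (.cons a b) s → Prog.Eval f x y t →
      Prog.Eval (.cond c f g) x y (s + t + x.size)
  | cond_false {c f g : Prog} {x y : Data} {s t : ℕ} :
      Prog.Eval c x .nil s → Prog.Eval g x y t →
      Prog.Eval (.cond c f g) x y (s + t + x.size)
  | loop_done {c f : Prog} {x : Data} {s : ℕ} :
      Prog.Eval c x .nil s → Prog.Eval (.loop c f) x x (s + x.size)
  | loop_step {c f : Prog} {x a b y z : Data} {s t u : ℕ} :
      Prog.Eval c x (.cons a b) s → Prog.Eval f x y t → Prog.Eval (.loop c f) y z u →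
      Prog.Eval (.loop c f) x z (s + t + u + x.size)

/-- The search problem with instances `I ∈ D`, presented to the program as `enc I`, and with
`Sol I y` meaning that `y` is an encoded solution of `I`, is solvable in time polynomial in the
size of the encoded instance, by one program for all instances in `D`. -/
def PolyTimeSolvableOn {ι : Type} (D : Set ι) (enc : ι → Data) (Sol : ι → Data → Prop) : Prop :=
  ∃ (p : Prog) (q : Polynomial ℕ), ∀ I ∈ D, ∃ (y : Data) (t : ℕ),
    p.Eval (enc I) y t ∧ t ≤ q.eval (enc I).size ∧ Sol I y

/-! ### Encodings -/

namespace Data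

def ofList : List Data → Data
  | [] => nil
  | a :: l => cons a (ofList l)

def ofBool : Bool → Data
  | false => nil
  | true => cons nil nil

/-- Binary representation, least significant bit first. -/
def ofNat (n : ℕ) : Data := ofList (n.bits.map ofBool)

def ofNNRat (q : ℚ≥0) : Data := cons (ofNat q.num) (ofNat q.den)

def ofVector {k : ℕ} (f : Fin k → Data) : Data := ofList (List.ofFn f)

open Classical in
/-- Characteristic vector of a set. -/
def ofFinset {k : ℕ} (S : Finset (Fin k)) : Data :=
  ofVector fun i => ofBool (decide (i ∈ S))

open Classical in
/-- Adjacency matrix of a graph. -/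
def ofGraph {k : ℕ} (G : SimpleGraph (Fin k)) : Data :=
  ofVector fun i => ofVector fun j => ofBool (decide (G.Adj i j))

end Data

/-! ### Maximum weighted independent set -/

/-- A class of finite graphs. -/
abbrev GraphClass : Type := Set (Σ m : ℕ, SimpleGraph (Fin m))

/-- The graphs `G[S]`, for `G` in the class and `S` a set of vertices of `G`; the vertices in `S`
are renumbered in increasing order. Taking all vertices gives `G` itself. -/
def GraphClass.inducedSubgraphs (C : GraphClass) : GraphClass :=
  {H | ∃ (m : ℕ) (G : SimpleGraph (Fin m)) (e : Fin H.1 ↪o Fin m),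
    ⟨m, G⟩ ∈ C ∧ H.2 = G.comap e}

structure WeightedGraph : Type where
  m : ℕ
  graph : SimpleGraph (Fin m)
  weight : Fin m → ℚ≥0

namespace WeightedGraph

def encode (W : WeightedGraph) : Data :=
  .cons (.ofGraph W.graph) (.ofVector fun j => .ofNNRat (W.weight j))

def IsMaxWeightIndepSet (W : WeightedGraph) (S : Finset (Fin W.m)) : Prop :=
  W.graph.IsIndepSet (S : Set (Fin W.m)) ∧
    ∀ T : Finset (Fin W.m), W.graph.IsIndepSet (T : Set (Fin W.m)) →
      ∑ j ∈ T, W.weight j ≤ ∑ j ∈ S, W.weight j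

end WeightedGraph

/-- The maximum weighted independent set problem can be solved in polynomial time on the graphs
of the class `C`, for all vertex weights. -/
def MWISPolyTimeOn (C : GraphClass) : Prop :=
  PolyTimeSolvableOn {W : WeightedGraph | ⟨W.m, W.graph⟩ ∈ C} WeightedGraph.encode
    fun W y => ∃ S : Finset (Fin W.m), W.IsMaxWeightIndepSet S ∧ y = .ofFinset S

/-! ### Fair allocation of conflicting items -/

/-- `n` agents, `m` items, additive valuations given by the values of the single items, and a
conflict graph on the items. -/
structure ConflictInstance : Type where
  n : ℕ
  m : ℕ
  val : Fin n → Fin m → ℚ≥0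
  graph : SimpleGraph (Fin m)

namespace ConflictInstance

def encode (I : ConflictInstance) : Data :=
  .cons (.ofGraph I.graph) (.ofVector fun i => .ofVector fun j => .ofNNRat (I.val i j))

/-- The value of a bundle to agent `i`. -/
def value (I : ConflictInstance) (i : Fin I.n) (S : Finset (Fin I.m)) : ℚ≥0 :=
  ∑ j ∈ S, I.val i j

/-- `A` is a complete allocation (every item is in exactly one bundle; bundles may be empty), and
no bundle contains two conflicting items. -/
def IsFeasible (I : ConflictInstance) (A : Fin I.n → Finset (Fin I.m)) : Prop :=
  (∀ j, ∃! i, j ∈ A i) ∧ ∀ i, I.graph.IsIndepSet (A i : Set (Fin I.m))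

/-- The maximin share of agent `i`. -/
def mms (I : ConflictInstance) (i : Fin I.n) : ℝ :=
  ⨆ A : {A : Fin I.n → Finset (Fin I.m) // I.IsFeasible A}, ⨅ k : Fin I.n,
    (I.value i (A.1 k) : ℝ)

def IsApproxMMS (I : ConflictInstance) (α : ℝ) (A : Fin I.n → Finset (Fin I.m)) : Prop :=
  I.IsFeasible A ∧ ∀ i, α * I.mms i ≤ (I.value i (A i) : ℝ)

open Classical in
/-- The maximum degree of the conflict graph. -/
def maxDegree (I : ConflictInstance) : ℕ := I.graph.maxDegree

/-- The output: one characteristic vector for each agent. -/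
def encodeAllocation (I : ConflictInstance) (A : Fin I.n → Finset (Fin I.m)) : Data :=
  .ofVector fun i => .ofFinset (A i)

end ConflictInstance

end

noncomputable section

/-! ### Polynomial bounds -/

/-! The algorithm is bag filling with adaptive thresholds. The values of each agent are scaled to
integers, and `θ i` is an upper bound for the scaled maximin share of `i`, at the start the value of
all items. An agent is satisfied if its bundle is worth at least `θ i / 8`. While some agent `i` is
unsatisfied, a maximum weight independent set of free items is computed for the values of `i`. If it
is worth at least `θ i / 8`, it is shrunk to a minimal set that still satisfies some unsatisfied
agent, who receives it. Otherwise `θ i` is halved and all bundles are taken back.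

Halving is sound by a counting argument (`Inv.exists_val_le`). By minimality, every bundle with two
or more items is worth less than `θ i / 4` to the unsatisfied agent `i`. Suppose that all bundles of
a feasible allocation `Q` are worth more than `θ i / 2` to `i`. Discard those that contain an item
of a singleton bundle, at most one per singleton. Since `i` holds nothing, the remaining bundles of
`Q` outnumber the bundles with several items. Their free parts are independent, hence worth less
than `θ i / 8` each, and the rest of them lies in the bundles with several items. So on average they
are worth less than `3 * θ i / 8`, a contradiction.

Each halving removes a binary digit of a threshold, and between halvings each step satisfies one
more agent, so there are polynomially many steps (`measure_restart`, `measure_assign`). When all are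
satisfied, the remaining items are placed greedily; with more agents than the maximum degree, some
bundle is always free of conflicts (`complete_spec`), and values only grow.

For the running time, `Comp` and `PT` express polynomial-time computability of families of trees and
of functions between encoded types. Closure properties (composition, folds over lists, binary
arithmetic) give each part of the algorithm, and `Comp.while` gives the main loop, whose states keep
polynomial size. -/

theorem Polynomial.eval_mono_nat (q : Polynomial ℕ) {a b : ℕ} (h : a ≤ b) :
    q.eval a ≤ q.eval b := by
  rw [Polynomial.eval_eq_sum_range, Polynomial.eval_eq_sum_range]
  exact Finset.sum_le_sum fun i _ => Nat.mul_le_mul_left _ (Nat.pow_le_pow_left h i)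

/-- The quantity `f` is bounded by a polynomial in the quantity `s`. -/
def PolyBound {ι : Type*} (s f : ι → ℕ) : Prop :=
  ∃ q : Polynomial ℕ, ∀ i, f i ≤ q.eval (s i)

namespace PolyBound

variable {ι κ : Type*} {s f g h : ι → ℕ}

theorem of_le (hg : PolyBound s g) (hfg : ∀ i, f i ≤ g i) : PolyBound s f := by
  obtain ⟨q, hq⟩ := hg
  exact ⟨q, fun i => (hfg i).trans (hq i)⟩

theorem self : PolyBound s s := ⟨.X, fun i => by simp⟩

theorem const (c : ℕ) : PolyBound s fun _ => c := ⟨.C c, fun i => by simp⟩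

theorem add (hf : PolyBound s f) (hg : PolyBound s g) : PolyBound s fun i => f i + g i := by
  obtain ⟨p, hp⟩ := hf
  obtain ⟨q, hq⟩ := hg
  exact ⟨p + q, fun i => by simpa using Nat.add_le_add (hp i) (hq i)⟩

theorem mul (hf : PolyBound s f) (hg : PolyBound s g) : PolyBound s fun i => f i * g i := by
  obtain ⟨p, hp⟩ := hf
  obtain ⟨q, hq⟩ := hg
  exact ⟨p * q, fun i => by simpa using Nat.mul_le_mul (hp i) (hq i)⟩

theorem mono {s' : ι → ℕ} (hf : PolyBound s f) (h : ∀ i, s i ≤ s' i) : PolyBound s' f := by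
  obtain ⟨q, hq⟩ := hf
  exact ⟨q, fun i => (hq i).trans (q.eval_mono_nat (h i))⟩

theorem trans (hf : PolyBound s f) (hg : PolyBound f g) : PolyBound s g := by
  obtain ⟨p, hp⟩ := hf
  obtain ⟨q, hq⟩ := hg
  exact ⟨q.comp p, fun i => by
    simpa using (hq i).trans (q.eval_mono_nat (hp i))⟩

theorem reindex (hf : PolyBound s f) (e : κ → ι) :
    PolyBound (fun k => s (e k)) fun k => f (e k) := by
  obtain ⟨q, hq⟩ := hf
  exact ⟨q, fun k => hq (e k)⟩

end PolyBound

/-! ### Polynomial-time transformations of families of trees -/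

theorem Data.size_pos (x : Data) : 0 < x.size := by cases x <;> simp [Data.size]

/-- Since reading is charged by size, a time bound is also a bound on the output; this is what makes
polynomial bounds compose. -/
theorem Prog.Eval.size_le {p : Prog} {x y : Data} {t : ℕ} (h : p.Eval x y t) :
    x.size ≤ t ∧ y.size ≤ t := by
  induction h with
  | id x => simp
  | nil x => exact ⟨le_rfl, x.size_pos⟩
  | head x => cases x <;> simp [Data.head, Data.size]; omega
  | tail x => cases x <;> simp [Data.tail, Data.size]; omega
  | @pair f g x y z s t _ _ ih₁ ih₂ =>
    have := x.size_pos
    simp only [Data.size]; omega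
  | seq _ _ ih₁ ih₂ => omega
  | cond_true _ _ ih₁ ih₂ => omega
  | cond_false _ _ ih₁ ih₂ => omega
  | loop_done _ ih => omega
  | loop_step _ _ _ ih₁ ih₂ ih₃ => omega

/-- Some program turns `a i` into `b i`, for every index `i`, in time polynomial in the size of
`a i`. -/
def Comp {ι : Type*} (a b : ι → Data) : Prop :=
  ∃ p : Prog, ∃ t : ι → ℕ, PolyBound (fun i => (a i).size) t ∧ ∀ i, p.Eval (a i) (b i) (t i)

namespace Comp

variable {ι κ : Type*} {a b c : ι → Data}

theorem size_bound (h : Comp a b) : PolyBound (fun i => (a i).size) fun i => (b i).size := by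
  obtain ⟨p, t, ht, hp⟩ := h
  exact ht.of_le fun i => (hp i).size_le.2

theorem id : Comp a a := ⟨.id, _, .self, fun i => .id (a i)⟩

theorem nil : Comp a fun _ => .nil := ⟨.nil, _, .self, fun i => .nil (a i)⟩

theorem head : Comp a fun i => (a i).head := ⟨.head, _, .self, fun i => .head (a i)⟩

theorem tail : Comp a fun i => (a i).tail := ⟨.tail, _, .self, fun i => .tail (a i)⟩

theorem trans (h₁ : Comp a b) (h₂ : Comp b c) : Comp a c := by
  have hb := h₁.size_bound
  obtain ⟨p, t, ht, hp⟩ := h₁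
  obtain ⟨q, u, hu, hq⟩ := h₂
  exact ⟨.seq p q, _, ht.add (hb.trans hu), fun i => .seq (hp i) (hq i)⟩

theorem cons (h₁ : Comp a b) (h₂ : Comp a c) : Comp a fun i => .cons (b i) (c i) := by
  obtain ⟨p, t, ht, hp⟩ := h₁
  obtain ⟨q, u, hu, hq⟩ := h₂
  exact ⟨.pair p q, _, (ht.add hu).add .self, fun i => .pair (hp i) (hq i)⟩

theorem const (d : Data) : Comp a fun _ => d := by
  induction d with
  | nil => exact nil
  | cons x y ihx ihy => exact ihx.cons ihy

theorem reindex (h : Comp a b) (e : κ → ι) : Comp (fun k => a (e k)) fun k => b (e k) := by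
  obtain ⟨p, t, ht, hp⟩ := h
  exact ⟨p, _, ht.reindex e, fun k => hp (e k)⟩

theorem ite {d : ι → Bool} {e : ι → Data} (hd : Comp a e) (he : ∀ i, e i = .nil ↔ d i = false)
    (hb : Comp a b) (hc : Comp a c) : Comp a fun i => if d i then b i else c i := by
  obtain ⟨r, v, hv, hr⟩ := hd
  obtain ⟨p, t, ht, hp⟩ := hb
  obtain ⟨q, u, hu, hq⟩ := hc
  refine ⟨.cond r p q, fun i => v i + (if d i then t i else u i) + (a i).size,
    (hv.add ((ht.add hu).of_le fun i => ?_)).add .self, fun i => ?_⟩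
  · split <;> omega
  · have := hr i
    have hi := he i
    cases h : e i with
    | nil =>
      rw [h] at this hi
      simp only [hi.1 rfl]
      exact .cond_false this (hq i)
    | cons x y =>
      rw [h] at this hi
      have hi : d i = true := by simpa using hi
      simp only [hi, if_true]
      exact .cond_true this (hp i)

/-- A loop that passes through the states `s i 0, …, s i (N i)`. -/
theorem loop {s : ι → ℕ → Data} {N : ι → ℕ}
    (hcond : Comp (fun j : {j : ι × ℕ // j.2 ≤ N j.1} => s j.1.1 j.1.2)
      fun j => .ofBool (decide (j.1.2 < N j.1.1)))
    (hstep : Comp (fun j : {j : ι × ℕ // j.2 < N j.1} => s j.1.1 j.1.2)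
      fun j => s j.1.1 (j.1.2 + 1))
    (hN : PolyBound (fun i => (s i 0).size) N)
    (hs : PolyBound (fun j : {j : ι × ℕ // j.2 ≤ N j.1} => (s j.1.1 0).size)
      fun j => (s j.1.1 j.1.2).size) :
    Comp (fun i => s i 0) fun i => s i (N i) := by
  obtain ⟨p, t, ht, hp⟩ := hcond
  obtain ⟨q, u, hu, hq⟩ := hstep
  obtain ⟨T, hT⟩ := hs.trans ht
  obtain ⟨S, hS⟩ := hs
  obtain ⟨U, hU⟩ := hu
  let z : ι → ℕ := fun i => (s i 0).size
  let w : ι → ℕ := fun i => T.eval (z i) + U.eval (S.eval (z i)) + S.eval (z i)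
  -- Induction on the number `d` of iterations left. Each costs at most `w i`, and the last failing
  -- test accounts for the extra 1.
  have key : ∀ i d k, d + k = N i →
      ∃ v ≤ (d + 1) * w i, (Prog.loop p q).Eval (s i k) (s i (N i)) v := by
    intro i d
    induction d with
    | zero =>
      intro k hk
      obtain rfl : k = N i := by omega
      have h₁ := hp ⟨(i, N i), le_rfl⟩
      have h₂ := hT ⟨(i, N i), le_rfl⟩
      have h₃ := hS ⟨(i, N i), le_rfl⟩
      simp only [lt_irrefl, decide_false, Data.ofBool] at h₁ h₂ h₃
      refine ⟨_, ?_, .loop_done h₁⟩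
      simp only [w, z]
      omega
    | succ d ih =>
      intro k hk
      have hlt : k < N i := by omega
      obtain ⟨v, hv, hv'⟩ := ih (k + 1) (by omega)
      have h₁ := hp ⟨(i, k), hlt.le⟩
      have h₂ := hT ⟨(i, k), hlt.le⟩
      have h₃ := hS ⟨(i, k), hlt.le⟩
      have h₄ := hq ⟨(i, k), hlt⟩
      have h₅ := hU ⟨(i, k), hlt⟩
      simp only [hlt, decide_true, Data.ofBool] at h₁ h₂ h₃ h₄ h₅
      refine ⟨_, ?_, .loop_step h₁ h₄ hv'⟩
      have h₆ := U.eval_mono_nat h₃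
      have h₇ : (d + 1 + 1) * w i = (d + 1) * w i + w i := by ring
      rw [h₇]
      simp only [w, z] at *
      omega
  have key' : ∀ i, ∃ v ≤ (N i + 1) * w i, (Prog.loop p q).Eval (s i 0) (s i (N i)) v :=
    fun i => key i (N i) 0 rfl
  choose v hv hv' using key'
  refine ⟨.loop p q, v, PolyBound.of_le ((hN.add (.const 1)).mul ?_) hv, hv'⟩
  exact ⟨T + U.comp S + S, fun i => by simp [w, z]⟩

end Comp

/-! ### Encoded types -/

/-- Types whose elements are represented by trees. -/
class Enc (α : Type*) where
  enc : α → Data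


namespace Enc

instance : Enc Data := ⟨fun x => x⟩
instance : Enc Bool := ⟨Data.ofBool⟩
instance : Enc ℕ := ⟨Data.ofNat⟩
instance {α β : Type*} [Enc α] [Enc β] : Enc (α × β) := ⟨fun x => .cons (enc x.1) (enc x.2)⟩
instance {α : Type*} [Enc α] : Enc (List α) := ⟨fun l => .ofList (l.map enc)⟩

variable {α β : Type*} [Enc α] [Enc β]

/-- Size of the encoding. -/
def esize (x : α) : ℕ := (enc x).size

theorem enc_pair (x : α) (y : β) : enc (x, y) = .cons (enc x) (enc y) := rfl
theorem enc_nil : enc ([] : List α) = .nil := rfl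
theorem enc_cons (x : α) (l : List α) : enc (x :: l) = .cons (enc x) (enc l) := rfl
theorem enc_bits (n : ℕ) : enc n.bits = enc n := rfl

theorem esize_pair (x : α) (y : β) : esize (x, y) = esize x + esize y + 1 := rfl
theorem esize_nil : esize ([] : List α) = 1 := rfl
theorem esize_cons (x : α) (l : List α) : esize (x :: l) = esize x + esize l + 1 := rfl
theorem esize_pos (x : α) : 0 < esize x := Data.size_pos _
theorem esize_bool_le (b : Bool) : esize b ≤ 3 := by cases b <;> decide

theorem length_le_esize (l : List α) : l.length ≤ esize l := by
  induction l with
  | nil => simp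
  | cons a l ih => simp only [List.length_cons, esize_cons]; omega

theorem esize_le_of_mem {x : α} {l : List α} (h : x ∈ l) : esize x ≤ esize l := by
  induction l with
  | nil => simp at h
  | cons a l ih =>
    rw [esize_cons]
    rcases List.mem_cons.1 h with rfl | h
    · omega
    · have := ih h; omega

end Enc

open Enc

/-- Polynomial-time computability of a function between encoded types. -/
@[fun_prop]
def PT {α β : Type*} [Enc α] [Enc β] (f : α → β) : Prop := Comp enc fun x => enc (f x)

namespace PT

variable {α β γ δ : Type*} [Enc α] [Enc β] [Enc γ] [Enc δ]

theorem size_bound {f : α → β} (h : PT f) : PolyBound esize fun x => esize (f x) :=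
  Comp.size_bound h

/-- Only the encodings matter, so a value may be exchanged for one of another type with the same
tree, such as a number for its list of bits. -/
theorem of_enc_eq {f : α → β} {g : α → γ} (hf : PT f) (h : ∀ x, enc (g x) = enc (f x)) :
    PT g := by
  unfold PT at *
  simpa only [h] using hf

@[fun_prop]
theorem id : PT fun x : α => x := Comp.id

@[fun_prop]
theorem const (b : β) : PT fun _ : α => b := Comp.const _

@[fun_prop]
theorem comp {g : β → γ} {f : α → β} (hg : PT g) (hf : PT f) : PT fun x => g (f x) :=
  Comp.trans hf (Comp.reindex hg f)

@[fun_prop]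
theorem prodMk {f : α → β} {g : α → γ} (hf : PT f) (hg : PT g) : PT fun x => (f x, g x) :=
  Comp.cons hf hg

@[fun_prop]
theorem fst {f : α → β × γ} (hf : PT f) : PT fun x => (f x).1 :=
  comp (g := Prod.fst) (Comp.head (a := (enc : β × γ → Data))) hf

@[fun_prop]
theorem snd {f : α → β × γ} (hf : PT f) : PT fun x => (f x).2 :=
  comp (g := Prod.snd) (Comp.tail (a := (enc : β × γ → Data))) hf

theorem ite_of_nil {c : α → Bool} {d : α → δ} {f g : α → β} (hd : PT d)
    (hdc : ∀ x, enc (d x) = .nil ↔ c x = false) (hf : PT f) (hg : PT g) :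
    PT fun x => if c x = true then f x else g x := by
  have := Comp.ite (d := c) hd hdc hf hg
  unfold PT
  convert this using 2 with x
  beta_reduce
  split <;> rfl

@[fun_prop]
theorem ite {c : α → Bool} {f g : α → β} (hc : PT c) (hf : PT f) (hg : PT g) :
    PT fun x => if c x = true then f x else g x :=
  ite_of_nil hc (fun x => by cases c x <;> simp [enc, Data.ofBool]) hf hg

@[fun_prop]
theorem cons {f : α → β} {g : α → List β} (hf : PT f) (hg : PT g) :
    PT fun x => f x :: g x :=
  Comp.cons hf hg

@[fun_prop]
theorem tail {f : α → List β} (hf : PT f) : PT fun x => (f x).tail :=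
  comp (g := List.tail) (of_enc_eq (γ := List β)
    (f := fun l : List β => (enc l).tail) Comp.tail (by rintro (_ | _) <;> rfl)) hf

@[fun_prop]
theorem isEmpty {f : α → List β} (hf : PT f) : PT fun x => (f x).isEmpty := by
  have := ite_of_nil (c := fun x => !(f x).isEmpty) hf
    (fun x => by cases f x <;> simp [enc, Data.ofList]) (const false) (const true)
  convert this using 2 with x
  cases f x <;> simp

@[fun_prop]
theorem not {f : α → Bool} (hf : PT f) : PT fun x => !f x := by
  convert ite hf (const false) (const true) using 2 with x
  cases f x <;> simp

@[fun_prop]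
theorem and {f g : α → Bool} (hf : PT f) (hg : PT g) : PT fun x => f x && g x := by
  convert ite hf hg (const false) using 2 with x
  cases f x <;> simp

@[fun_prop]
theorem or {f g : α → Bool} (hf : PT f) (hg : PT g) : PT fun x => f x || g x := by
  convert ite hf (const true) hg using 2 with x
  cases f x <;> simp

/-- Folding over a list, if the accumulator stays polynomially bounded. -/
theorem foldl_of_bound {f : γ → β → α → β} {l : γ → List α} {b : γ → β}
    (hf : PT fun p : γ × β × α => f p.1 p.2.1 p.2.2) (hl : PT l) (hb : PT b)
    (hbd : PolyBound (fun j : γ × ℕ => esize j.1)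
      fun j => esize (((l j.1).take j.2).foldl (f j.1) (b j.1))) :
    PT fun c => (l c).foldl (f c) (b c) := by
  -- The loop carries the unread part of the list, the accumulator, and the context that every step
  -- needs.
  let s : γ → ℕ → Data := fun c k => enc ((l c).drop k, ((l c).take k).foldl (f c) (b c), c)
  have h₀ : Comp enc fun c => s c 0 := by
    have : PT fun c => (l c, b c, c) := by fun_prop
    exact this
  have hsz : ∀ c, esize c ≤ (s c 0).size := fun c => by
    simp only [s, enc_pair, Data.size, esize]; omega
  have h₁ : Comp (fun c => s c 0) fun c => s c (l c).length := by
    refine Comp.loop (N := fun c => (l c).length) ?_ ?_ ?_ ?_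
    · have := Comp.ite (d := fun j : {j : γ × ℕ // j.2 ≤ (l j.1).length} =>
          decide (j.1.2 < (l j.1.1).length)) (Comp.head (a := fun j => s j.1.1 j.1.2)) ?_
          (Comp.const (.cons .nil .nil)) Comp.nil
      · convert this using 2 with j
        by_cases h : j.1.2 < (l j.1.1).length <;> simp [h, Data.ofBool]
      · rintro ⟨⟨c, k⟩, hk⟩
        simp only [s, enc_pair, Data.head]
        by_cases h : k < (l c).length
        · rw [List.drop_eq_getElem_cons h]
          simp only [enc_cons, h, decide_true]; simp
        · rw [List.drop_of_length_le (by omega)]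
          simp [enc_nil, h]
    · have hst : Comp (fun j : {j : γ × ℕ // j.2 < (l j.1).length} => s j.1.1 j.1.2)
          fun j => enc ((l j.1.1).drop (j.1.2 + 1)) := by
        convert Comp.trans Comp.head Comp.tail using 2 with j
        simp only [s, enc_pair, Data.head]
        rw [List.drop_eq_getElem_cons j.2]
        rfl
      have harg : Comp (fun j : {j : γ × ℕ // j.2 < (l j.1).length} => s j.1.1 j.1.2)
          fun j => enc (j.1.1, ((l j.1.1).take j.1.2).foldl (f j.1.1) (b j.1.1),
            (l j.1.1)[j.1.2]'j.2) := by
        have := (Comp.tail.trans Comp.tail).cons ((Comp.tail.trans Comp.head).cons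
          (Comp.head.trans Comp.head)) (a := fun j : {j : γ × ℕ // j.2 < (l j.1).length} =>
            s j.1.1 j.1.2)
        convert this using 2 with j
        simp only [s, enc_pair, Data.head, Data.tail]
        rw [List.drop_eq_getElem_cons j.2]
        rfl
      have hnew := harg.trans (Comp.reindex hf _)
      have hctx := Comp.trans Comp.tail Comp.tail
        (a := fun j : {j : γ × ℕ // j.2 < (l j.1).length} => s j.1.1 j.1.2)
      convert hst.cons (hnew.cons hctx) using 2 with j
      simp only [s, enc_pair, Data.tail]
      rw [List.take_add_one, List.getElem?_eq_getElem j.2]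
      simp only [Option.toList_some, List.foldl_append, List.foldl_cons, List.foldl_nil]
    · exact ((hl.size_bound.of_le fun c => length_le_esize (l c))).mono hsz
    · have h₂ := hbd.reindex fun j : {j : γ × ℕ // j.2 ≤ (l j.1).length} => j.1
      have h₃ := hl.size_bound.reindex fun j : {j : γ × ℕ // j.2 ≤ (l j.1).length} => j.1.1
      have h₄ := ((h₂.add h₃).add (PolyBound.self.add (.const 2))).mono
        (s' := fun j => (s j.1.1 0).size) fun j => hsz j.1.1
      refine h₄.of_le fun j => ?_
      have : ∀ (k : ℕ) (l : List α), esize (l.drop k) ≤ esize l := by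
        intro k
        induction k with
        | zero => simp
        | succ k ih =>
          rintro (_ | ⟨a, l⟩)
          · simp
          · have := ih l
            simp only [List.drop_succ_cons, esize_cons]; omega
      have := this j.1.2 (l j.1.1)
      simp only [s, enc_pair, Data.size]
      simp only [esize] at *
      omega
  have h₂ := (h₀.trans h₁).trans (Comp.tail.trans Comp.head)
  unfold PT
  convert h₂ using 2 with c
  simp [s, enc_pair, Data.head, Data.tail]

/-- Folding over a list, if each step adds to the accumulator at most a polynomial amount. -/
theorem foldl {f : γ → β → α → β} {l : γ → List α} {b : γ → β}
    (hf : PT fun p : γ × β × α => f p.1 p.2.1 p.2.2) (hl : PT l) (hb : PT b)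
    (hbd : ∃ q : Polynomial ℕ, ∀ c x a, esize (f c x a) ≤ esize x + q.eval (esize c + esize a)) :
    PT fun c => (l c).foldl (f c) (b c) := by
  refine foldl_of_bound hf hl hb ?_
  obtain ⟨q, hq⟩ := hbd
  obtain ⟨r, hr⟩ := hl.size_bound
  obtain ⟨u, hu⟩ := hb.size_bound
  -- Here `u` bounds the initial accumulator, and `r` bounds both the number of list elements and
  -- the size of each.
  refine ⟨u + r * q.comp (.X + r), fun j => ?_⟩
  obtain ⟨c, k⟩ := j
  have key : ∀ (l' : List α) (x : β), (∀ a ∈ l', esize a ≤ r.eval (esize c)) →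
      esize (l'.foldl (f c) x) ≤ esize x + l'.length * q.eval (esize c + r.eval (esize c)) := by
    intro l'
    induction l' with
    | nil => simp
    | cons a l' ih =>
      intro x h
      have h₁ := ih (f c x a) fun a' ha' => h a' (List.mem_cons_of_mem _ ha')
      have h₂ := hq c x a
      have h₃ := q.eval_mono_nat (Nat.add_le_add_left (h a List.mem_cons_self) (esize c))
      simp only [List.foldl_cons, List.length_cons, add_mul, one_mul]
      omega
  have h₁ := key ((l c).take k) (b c) fun a ha =>
    (esize_le_of_mem (List.mem_of_mem_take ha)).trans (hr c)
  have h₂ : ((l c).take k).length ≤ r.eval (esize c) := by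
    rw [List.length_take]
    exact (min_le_right _ _).trans ((length_le_esize _).trans (hr c))
  have h₃ := Nat.mul_le_mul_right (q.eval (esize c + r.eval (esize c))) h₂
  have h₄ : esize (b c) ≤ u.eval (esize c) := hu c
  simp only [Polynomial.eval_add, Polynomial.eval_mul, Polynomial.eval_comp, Polynomial.eval_X]
  omega

end PT

/-! ### Lists -/

/-- Replace the first element that satisfies `p` by its image under `f`. -/
def List.updateFirst {α : Type*} (p : α → Bool) (f : α → α) : List α → List α
  | [] => []
  | a :: l => if p a = true then f a :: l else a :: List.updateFirst p f l

namespace PT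

variable {α β γ δ : Type*} [Enc α] [Enc β] [Enc γ] [Enc δ]

@[fun_prop]
theorem reverse {l : γ → List α} (hl : PT l) : PT fun c => (l c).reverse := by
  have : PT fun c => (l c).foldl (fun acc a => a :: acc) [] :=
    foldl (f := fun _ acc a => a :: acc) (by fun_prop) hl (by fun_prop)
      ⟨.X + 1, fun c x a => by simp only [esize_cons]; simp; omega⟩
  convert this using 2 with c
  simp

@[fun_prop]
theorem map {g : γ → α → β} {l : γ → List α} (hg : PT fun p : γ × α => g p.1 p.2) (hl : PT l) :
    PT fun c => (l c).map (g c) := by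
  have : PT fun c => ((l c).foldl (fun acc a => g c a :: acc) []).reverse := by
    refine reverse (foldl (f := fun c acc a => g c a :: acc) ?_ hl (by fun_prop) ?_)
    · exact cons (comp hg (f := fun p : γ × List β × α => (p.1, p.2.2)) (by fun_prop))
        (by fun_prop)
    · obtain ⟨q, hq⟩ := hg.size_bound
      refine ⟨q.comp (.X + 1) + 1, fun c x a => ?_⟩
      have : esize (g c a) ≤ q.eval (esize (c, a)) := hq (c, a)
      rw [esize_pair] at this
      simp only [esize_cons, Polynomial.eval_add, Polynomial.eval_comp, Polynomial.eval_X,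
        Polynomial.eval_one]
      omega
  convert this using 2 with c
  have key : ∀ (l : List α) (acc : List β),
      l.foldl (fun acc a => g c a :: acc) acc = (l.map (g c)).reverse ++ acc := by
    intro l
    induction l with
    | nil => simp
    | cons a l ih => intro acc; simp [ih]
  simp [key]

/-- The first element, or a default value. -/
theorem headD {l : γ → List α} (d : α) (hl : PT l) : PT fun c => (l c).headD d := by
  have h₁ : PT fun c => (enc (l c)).head := Comp.trans hl Comp.head
  refine of_enc_eq (ite (isEmpty hl) (const (enc d)) h₁) fun c => ?_
  cases l c <;> rfl

@[fun_prop]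
theorem zip {l : γ → List α} {l' : γ → List β} (hl : PT l) (hl' : PT l') :
    PT fun c => (l c).zip (l' c) := by
  -- The element `d` only makes `headD` total; its value has no effect, since nothing is paired once
  -- the second list is used up.
  rcases isEmpty_or_nonempty β with hβ | ⟨⟨d⟩⟩
  · convert const (α := γ) ([] : List (α × β)) using 2 with c
    have : l' c = [] := by
      cases h : l' c with
      | nil => rfl
      | cons b _ => exact (hβ.false b).elim
    simp [this]
  let f : γ → List β × List (α × β) → α → List β × List (α × β) := fun _ s a =>
    if s.1.isEmpty = true then s else (s.1.tail, (a, s.1.headD d) :: s.2)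
  have hf : PT fun p : γ × (List β × List (α × β)) × α => f p.1 p.2.1 p.2.2 :=
    ite (by fun_prop) (by fun_prop)
      (prodMk (by fun_prop) (cons (prodMk (by fun_prop) (headD d (by fun_prop))) (by fun_prop)))
  have : PT fun c => ((l c).foldl (f c) (l' c, [])).2.reverse := by
    refine reverse (snd (foldl hf hl (by fun_prop) ⟨.X + 2, ?_⟩))
    rintro c ⟨_ | ⟨b, r⟩, out⟩ a
    · simp [f]
    · simp [f, esize_pair, esize_cons]; omega
  convert this using 2 with c
  have key : ∀ (l : List α) (l' : List β) (out : List (α × β)),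
      (l.foldl (f c) (l', out)).2 = (l.zip l').reverse ++ out := by
    intro l
    induction l with
    | nil => simp
    | cons a l ih =>
      rintro (_ | ⟨b, r⟩) out
      · rw [List.foldl_cons]
        have : f c ([], out) a = ([], out) := by simp [f]
        rw [this, ih]
        simp
      · rw [List.foldl_cons]
        have : f c (b :: r, out) a = (r, (a, b) :: out) := by simp [f]
        rw [this, ih]
        simp
  simp [key]

theorem foldr {f : γ → α → β → β} {l : γ → List α} {b : γ → β}
    (hf : PT fun p : γ × α × β => f p.1 p.2.1 p.2.2) (hl : PT l) (hb : PT b)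
    (hbd : ∃ q : Polynomial ℕ, ∀ c x a, esize (f c a x) ≤ esize x + q.eval (esize c + esize a)) :
    PT fun c => (l c).foldr (f c) (b c) := by
  have : PT fun c => (l c).reverse.foldl (fun x a => f c a x) (b c) :=
    foldl (f := fun c x a => f c a x)
      (comp hf (f := fun p : γ × β × α => (p.1, p.2.2, p.2.1)) (by fun_prop)) (by fun_prop) hb hbd
  simpa using this

@[fun_prop]
theorem append {l l' : γ → List α} (hl : PT l) (hl' : PT l') : PT fun c => l c ++ l' c := by
  have : PT fun c => (l c).foldr (fun a r => a :: r) (l' c) :=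
    foldr (f := fun _ a r => a :: r) (by fun_prop) hl hl'
      ⟨.X + 1, fun c x a => by simp only [esize_cons]; simp; omega⟩
  simpa using this

@[fun_prop]
theorem any {p : γ → α → Bool} {l : γ → List α} (hp : PT fun x : γ × α => p x.1 x.2)
    (hl : PT l) : PT fun c => (l c).any (p c) := by
  have : PT fun c => (l c).foldr (fun a r => p c a || r) false :=
    foldr (f := fun c a r => p c a || r)
      (or (comp hp (f := fun x : γ × α × Bool => (x.1, x.2.1)) (by fun_prop)) (by fun_prop))
      hl (by fun_prop)
      ⟨3, fun c x a => by have := esize_bool_le (p c a || x); simp; omega⟩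
  convert this using 2 with c
  induction l c with
  | nil => rfl
  | cons a l ih => simp [ih]

theorem findD {p : γ → α → Bool} {l : γ → List α} {d : γ → α}
    (hp : PT fun x : γ × α => p x.1 x.2) (hl : PT l) (hd : PT d) :
    PT fun c => ((l c).find? (p c)).getD (d c) := by
  have : PT fun c => (l c).foldr (fun a r => if p c a = true then a else r) (d c) :=
    foldr (f := fun c a r => if p c a = true then a else r)
      (ite (comp hp (f := fun x : γ × α × α => (x.1, x.2.1)) (by fun_prop)) (by fun_prop)
        (by fun_prop)) hl hd
      ⟨.X, fun c x a => by split <;> simp; omega⟩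
  convert this using 2 with c
  induction l c with
  | nil => rfl
  | cons a l ih =>
    by_cases h : p c a = true
    · simp [h]
    · simp [h, ih]

theorem updateFirst {p : γ → α → Bool} {f : γ → α → α} {l : γ → List α}
    (hp : PT fun x : γ × α => p x.1 x.2) (hf : PT fun x : γ × α => f x.1 x.2) (hl : PT l) :
    PT fun c => (l c).updateFirst (p c) (f c) := by
  let g : γ → Bool × List α → α → Bool × List α := fun c s a =>
    if (!s.1 && p c a) = true then (true, f c a :: s.2) else (s.1, a :: s.2)
  have hg : PT fun x : γ × (Bool × List α) × α => g x.1 x.2.1 x.2.2 :=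
    ite (and (by fun_prop)
        (comp hp (f := fun x : γ × (Bool × List α) × α => (x.1, x.2.2)) (by fun_prop)))
      (prodMk (by fun_prop) (cons
        (comp hf (f := fun x : γ × (Bool × List α) × α => (x.1, x.2.2)) (by fun_prop))
        (by fun_prop))) (by fun_prop)
  have : PT fun c => ((l c).foldl (g c) (false, [])).2.reverse := by
    refine reverse (snd (foldl hg hl (by fun_prop) ?_))
    obtain ⟨q, hq⟩ := hf.size_bound
    refine ⟨q.comp (.X + 1) + .X + 4, fun c x a => ?_⟩
    have h₁ : esize (f c a) ≤ q.eval (esize (c, a)) := hq (c, a)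
    have h₂ := esize_bool_le true
    rw [esize_pair] at h₁
    obtain ⟨x, out⟩ := x
    have : ∀ n : ℕ, (4 : Polynomial ℕ).eval n = 4 := fun n => by simp
    simp only [g, Polynomial.eval_add, Polynomial.eval_comp, Polynomial.eval_X,
        Polynomial.eval_one, this]
    split <;> simp only [esize_pair, esize_cons] <;> omega
  convert this using 2 with c
  have key₁ : ∀ (l out : List α), (l.foldl (g c) (true, out)).2 = l.reverse ++ out := by
    intro l
    induction l with
    | nil => simp
    | cons a l ih =>
      intro out
      have : g c (true, out) a = (true, a :: out) := by simp [g]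
      rw [List.foldl_cons, this, ih]
      simp
  have key₂ : ∀ (l out : List α),
      (l.foldl (g c) (false, out)).2 = (l.updateFirst (p c) (f c)).reverse ++ out := by
    intro l
    induction l with
    | nil => simp [List.updateFirst]
    | cons a l ih =>
      intro out
      by_cases h : p c a = true
      · have : g c (false, out) a = (true, f c a :: out) := by simp [g, h]
        rw [List.foldl_cons, this, key₁]
        simp [List.updateFirst, h]
      · have : g c (false, out) a = (false, a :: out) := by simp [g, h]
        rw [List.foldl_cons, this, ih]
        simp [List.updateFirst, h]
  simp [key₂]

/-! ### Binary arithmetic -/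

theorem bits {n : γ → ℕ} (hn : PT n) : PT fun c => (n c).bits := hn

@[fun_prop]
theorem bit {b : γ → Bool} {n : γ → ℕ} (hb : PT b) (hn : PT n) :
    PT fun c => Nat.bit (b c) (n c) := by
  -- `Nat.bits` has no leading zeros, so a zero bit put below the number 0 must give the empty list.
  have : PT fun c => if (b c || !(n c).bits.isEmpty) = true then b c :: (n c).bits else [] := by
    have := bits hn
    fun_prop
  refine of_enc_eq this fun c => ?_
  rw [← enc_bits]
  by_cases h : n c = 0 ∧ b c = false
  · simp [h]
  · rw [Nat.bits_append_bit]
    · have hz : (n c).bits = [] ↔ n c = 0 := by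
        rw [← List.length_eq_zero_iff, Nat.size_eq_bits_len, Nat.size_eq_zero]
      rw [if_pos]
      by_cases h₁ : n c = 0
      · simpa [h₁] using h
      · simp [hz, h₁]
    · intro h₁
      simpa [h₁] using h

@[fun_prop]
theorem div2 {n : γ → ℕ} (hn : PT n) : PT fun c => (n c).div2 :=
  of_enc_eq (tail (bits hn)) fun c => by rw [← enc_bits, Nat.div2_bits_eq_tail]

@[fun_prop]
theorem bodd {n : γ → ℕ} (hn : PT n) : PT fun c => (n c).bodd := by
  convert headD false (bits hn) using 2 with c
  rw [Nat.bodd_eq_bits_head]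
  cases (n c).bits <;> rfl

end PT

theorem Nat.size_le_esize (n : ℕ) : n.size ≤ esize n := by
  rw [← Nat.size_eq_bits_len]
  exact length_le_esize n.bits

theorem Enc.esize_nat_le (n : ℕ) : esize n ≤ 4 * n.size + 1 := by
  rw [← Nat.size_eq_bits_len]
  change esize n.bits ≤ _
  induction n.bits with
  | nil => simp [esize_nil]
  | cons b l ih =>
    have := esize_bool_le b
    simp only [esize_cons, List.length_cons]; omega

theorem Nat.size_mul_le (a b : ℕ) : (a * b).size ≤ a.size + b.size := by
  rw [Nat.size_le, pow_add]
  exact Nat.mul_lt_mul'' (Nat.lt_size_self a) (Nat.lt_size_self b)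


namespace PT

variable {γ : Type*} [Enc γ]

/-- Iterated `Nat.bit`, most significant bit first. -/
theorem foldl_bit {n : γ → ℕ} {l : γ → List Bool} (hn : PT n) (hl : PT l) :
    PT fun c => (l c).foldl (fun k b => Nat.bit b k) (n c) := by
  refine foldl (f := fun _ k b => Nat.bit b k) (by fun_prop) hl hn ⟨4, fun c k b => ?_⟩
  have h : (Nat.bit b k).bits = [] ∨ (Nat.bit b k).bits = b :: k.bits := by
    by_cases h : k = 0 ∧ b = false
    · simp [h]
    · exact .inr (Nat.bits_append_bit _ _ fun hk => by simpa [hk] using h)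
  change esize (Nat.bit b k).bits ≤ esize k.bits + _
  have h₁ := esize_bool_le b
  rcases h with h | h <;> rw [h] <;>
    simp only [esize_nil, esize_cons, Polynomial.eval_ofNat] <;> omega

/-- One step of addition with carry: the two remaining summands, the carry, and the bits of the
sum found so far. -/
def addStep (s : (ℕ × ℕ) × Bool × List Bool) : (ℕ × ℕ) × Bool × List Bool :=
  ((s.1.1.div2, s.1.2.div2),
    (s.1.1.bodd && s.1.2.bodd || s.2.1 && (s.1.1.bodd || s.1.2.bodd)),
    (s.1.1.bodd ^^ s.1.2.bodd ^^ s.2.1) :: s.2.2)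

end PT

theorem Nat.div2_iterate_eq_zero (n k : ℕ) (h : n.size ≤ k) : Nat.div2^[k] n = 0 := by
  have key : ∀ k n, Nat.div2^[k] n = n / 2 ^ k := by
    intro k
    induction k with
    | zero => simp
    | succ k ih =>
      intro n
      rw [Function.iterate_succ_apply, ih, Nat.div2_val, Nat.div_div_eq_div_mul, pow_succ']
  rw [key]
  exact Nat.div_eq_of_lt (Nat.size_le.1 h)

theorem Enc.esize_div2_le (n : ℕ) : esize n.div2 ≤ esize n := by
  change esize n.div2.bits ≤ esize n.bits
  rw [Nat.div2_bits_eq_tail]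
  cases n.bits with
  | nil => simp
  | cons b l => simp only [List.tail_cons, esize_cons]; omega

theorem Nat.foldr_bit_bits (n : ℕ) : n.bits.foldr Nat.bit 0 = n := by
  induction n using Nat.binaryRec' with
  | zero => simp
  | bit b n h ih => rw [Nat.bits_append_bit _ _ h, List.foldr_cons, ih]

theorem Nat.size_foldl_bit_le (l : List Bool) (n : ℕ) :
    (l.foldl (fun k b => Nat.bit b k) n).size ≤ n.size + l.length := by
  induction l generalizing n with
  | nil => simp
  | cons b l ih =>
    have h₁ := ih (Nat.bit b n)
    have h₂ : (Nat.bit b n).size ≤ n.size + 1 := by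
      by_cases h : Nat.bit b n = 0
      · simp [h]
      · rw [Nat.size_bit h]
    simp only [List.foldl_cons, List.length_cons]
    omega

namespace PT

variable {γ : Type*} [Enc γ]

@[fun_prop]
theorem xor {f g : γ → Bool} (hf : PT f) (hg : PT g) : PT fun x => (f x ^^ g x) := by
  convert ite hf (not hg) hg using 2 with x
  cases f x <;> simp

@[fun_prop]
theorem addStep_comp {s : γ → (ℕ × ℕ) × Bool × List Bool} (hs : PT s) :
    PT fun c => addStep (s c) := by
  unfold addStep
  fun_prop

/-- The invariant of addition: the pending sum with its carry is the high part of a number whose low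
part consists of the bits already found, the newest being the most significant. -/
theorem foldl_bit_addStep (s : (ℕ × ℕ) × Bool × List Bool) :
    (addStep s).2.2.foldl (fun k b => Nat.bit b k)
      ((addStep s).1.1 + (addStep s).1.2 + (addStep s).2.1.toNat) =
    s.2.2.foldl (fun k b => Nat.bit b k) (s.1.1 + s.1.2 + s.2.1.toNat) := by
  obtain ⟨⟨x, y⟩, c, out⟩ := s
  simp only [addStep, List.foldl_cons]
  congr 1
  have hx := Nat.bodd_add_div2 x
  have hy := Nat.bodd_add_div2 y
  rw [Nat.bit_val]
  cases hx' : x.bodd <;> cases hy' : y.bodd <;> cases c <;> simp [hx', hy'] at * <;> omega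

theorem foldl_addStep {α : Type*} (l : List α) (s : (ℕ × ℕ) × Bool × List Bool) :
    let r := l.foldl (fun s _ => addStep s) s
    r.2.2.foldl (fun k b => Nat.bit b k) (r.1.1 + r.1.2 + r.2.1.toNat) =
      s.2.2.foldl (fun k b => Nat.bit b k) (s.1.1 + s.1.2 + s.2.1.toNat) ∧
    r.1.1 = Nat.div2^[l.length] s.1.1 ∧ r.1.2 = Nat.div2^[l.length] s.1.2 := by
  induction l generalizing s with
  | nil => simp
  | cons a l ih =>
    obtain ⟨h₁, h₂, h₃⟩ := ih (addStep s)
    refine ⟨h₁.trans (foldl_bit_addStep s), ?_, ?_⟩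
    · rw [List.foldl_cons, h₂]; rfl
    · rw [List.foldl_cons, h₃]; rfl

@[fun_prop]
theorem add {x y : γ → ℕ} (hx : PT x) (hy : PT y) : PT fun c => x c + y c := by
  -- The concatenated bit lists serve as a clock. It runs long enough to exhaust both summands, so
  -- that only the carry is left as high part.
  let r : γ → (ℕ × ℕ) × Bool × List Bool := fun c =>
    ((x c).bits ++ (y c).bits).foldl (fun s _ => addStep s) ((x c, y c), false, [])
  have hr : PT r := by
    refine foldl (f := fun _ s _ => addStep s) (by fun_prop) (append (bits hx) (bits hy))
      (by fun_prop) ⟨7, ?_⟩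
    rintro c ⟨⟨x, y⟩, b, out⟩ a
    have h₁ := esize_div2_le x
    have h₂ := esize_div2_le y
    have h₃ := esize_bool_le (x.bodd && y.bodd || b && (x.bodd || y.bodd))
    have h₄ := esize_bool_le (x.bodd ^^ y.bodd ^^ b)
    simp only [addStep, esize_pair, esize_cons, Polynomial.eval_ofNat]
    omega
  have : PT fun c => (r c).2.2.foldl (fun k b => Nat.bit b k) (Nat.bit (r c).2.1 0) :=
    foldl_bit (by fun_prop) (by fun_prop)
  convert this using 2 with c
  obtain ⟨h₁, h₂, h₃⟩ := foldl_addStep ((x c).bits ++ (y c).bits) ((x c, y c), false, [])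
  rw [Nat.div2_iterate_eq_zero _ _ (by simp [Nat.size_eq_bits_len])] at h₂ h₃
  rw [h₂, h₃] at h₁
  rw [Nat.bit_val]
  simp only [zero_add, mul_zero, Bool.toNat_false, add_zero, List.foldl_nil] at h₁ ⊢
  exact h₁.symm

/-- One step of the comparison of two numbers: the bits not yet read, and the result for the bits
that have been read. -/
def ltStep (s : (ℕ × ℕ) × Bool) : (ℕ × ℕ) × Bool :=
  ((s.1.1.div2, s.1.2.div2), if (s.1.1.bodd ^^ s.1.2.bodd) = true then s.1.2.bodd else s.2)

@[fun_prop]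
theorem ltStep_comp {s : γ → (ℕ × ℕ) × Bool} (hs : PT s) : PT fun c => ltStep (s c) := by
  unfold ltStep
  fun_prop

/-- Bits are read from the least significant one, so a later difference overrides an earlier one:
the stored answer counts only if the unread parts agree. -/
theorem foldl_ltStep {α : Type*} (l : List α) (s : (ℕ × ℕ) × Bool) :
    let r := l.foldl (fun s _ => ltStep s) s
    (if r.1.1 = r.1.2 then r.2 else decide (r.1.1 < r.1.2)) =
      (if s.1.1 = s.1.2 then s.2 else decide (s.1.1 < s.1.2)) ∧
    r.1.1 = Nat.div2^[l.length] s.1.1 ∧ r.1.2 = Nat.div2^[l.length] s.1.2 := by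
  induction l generalizing s with
  | nil => exact ⟨rfl, rfl, rfl⟩
  | cons a l ih =>
    obtain ⟨h₁, h₂, h₃⟩ := ih (ltStep s)
    refine ⟨h₁.trans ?_, ?_, ?_⟩
    · obtain ⟨⟨x, y⟩, c⟩ := s
      have hx := Nat.bodd_add_div2 x
      have hy := Nat.bodd_add_div2 y
      rcases lt_trichotomy x.div2 y.div2 with h | h | h
      · have h' : x < y := by
          have := Bool.toNat_lt x.bodd
          omega
        simp [ltStep, h.ne, h, h'.ne, h']
      · cases hx' : x.bodd <;> cases hy' : y.bodd <;> simp [hx', hy'] at hx hy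
        · have : x = y := by omega
          simp [ltStep, this]
        · have : x < y := by omega
          simp [ltStep, h, hx', hy', this, this.ne]
        · have : y < x := by omega
          simp [ltStep, h, hx', hy', this.le, this.ne']
        · have : x = y := by omega
          simp [ltStep, this]
      · have h' : y < x := by
          have := Bool.toNat_lt y.bodd
          omega
        simp [ltStep, h.ne', h'.ne', h.not_gt, h'.not_gt]
    · rw [List.foldl_cons, h₂]; rfl
    · rw [List.foldl_cons, h₃]; rfl

@[fun_prop]
theorem lt {x y : γ → ℕ} (hx : PT x) (hy : PT y) : PT fun c => decide (x c < y c) := by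
  have : PT fun c =>
      (((x c).bits ++ (y c).bits).foldl (fun s _ => ltStep s) ((x c, y c), false)).2 := by
    refine snd (foldl (f := fun _ s _ => ltStep s) (by fun_prop) (append (bits hx) (bits hy))
      (by fun_prop) ⟨3, ?_⟩)
    rintro c ⟨⟨x, y⟩, b⟩ a
    have h₁ := esize_div2_le x
    have h₂ := esize_div2_le y
    have h₃ := esize_bool_le (ltStep ((x, y), b)).2
    simp only [ltStep, esize_pair, Polynomial.eval_ofNat] at *
    omega
  convert this using 2 with c
  obtain ⟨h₁, h₂, h₃⟩ := foldl_ltStep ((x c).bits ++ (y c).bits) ((x c, y c), false)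
  rw [Nat.div2_iterate_eq_zero _ _ (by simp [Nat.size_eq_bits_len])] at h₂ h₃
  rw [h₂, h₃] at h₁
  simp only [if_true] at h₁
  rw [h₁]
  by_cases h : x c = y c <;> simp [h]

@[fun_prop]
theorem mul {x y : γ → ℕ} (hx : PT x) (hy : PT y) : PT fun c => x c * y c := by
  -- Horner's scheme from the most significant bit. Each intermediate value is a leading part of `x
  -- c` times `y c` (`key₀`), which bounds its size.
  let f : γ → ℕ → Bool → ℕ := fun c k b => Nat.bit false k + if b = true then y c else 0
  have key : ∀ c (l : List Bool) (k : ℕ),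
      l.foldl (f c) (k * y c) = l.foldl (fun k b => Nat.bit b k) k * y c := by
    intro c l
    induction l with
    | nil => simp
    | cons b l ih =>
      intro k
      rw [List.foldl_cons, List.foldl_cons, ← ih]
      congr 1
      cases b <;> simp [f, Nat.bit_val] <;> ring
  have key₀ : ∀ c (l : List Bool),
      l.foldl (f c) 0 = l.foldl (fun k b => Nat.bit b k) 0 * y c := fun c l => by
    simpa using key c l 0
  have : PT fun c => (x c).bits.reverse.foldl (f c) 0 := by
    refine foldl_of_bound ?_ (reverse (bits hx)) (const 0) ?_
    · have hy' : PT fun p : γ × ℕ × Bool => y p.1 := comp hy (by fun_prop)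
      fun_prop
    · have hxb := hx.size_bound.reindex fun j : γ × ℕ => j.1
      have hyb := hy.size_bound.reindex fun j : γ × ℕ => j.1
      refine (((PolyBound.const 4).mul (hxb.add hyb)).add (.const 1)).of_le fun j => ?_
      refine (esize_nat_le _).trans ?_
      rw [key₀]
      have h₁ := Nat.size_mul_le
        (((x j.1).bits.reverse.take j.2).foldl (fun k b => Nat.bit b k) 0) (y j.1)
      have h₂ := Nat.size_foldl_bit_le ((x j.1).bits.reverse.take j.2) 0
      have h₃ := Nat.size_le_esize (x j.1)
      have h₄ := Nat.size_le_esize (y j.1)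
      simp only [List.length_take, List.length_reverse, Nat.size_eq_bits_len, Nat.size_zero]
        at h₂
      omega
  convert this using 2 with c
  rw [key₀, List.foldl_reverse]
  rw [Nat.foldr_bit_bits]

end PT

/-! ### Masks -/

namespace Mask

def diff (S T : List Bool) : List Bool := (S.zip T).map fun x => x.1 && !x.2

def inter (S T : List Bool) : List Bool := (S.zip T).map fun x => x.1 && x.2

def union (S T : List Bool) : List Bool := (S.zip T).map fun x => x.1 || x.2

def overlap (S T : List Bool) : Bool := (S.zip T).any fun x => x.1 && x.2

/-- The masks of the singletons of `Fin k`. -/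
def singletons (k : ℕ) : List (List Bool) :=
  List.ofFn fun i : Fin k => List.ofFn fun j : Fin k => decide (j = i)

theorem singletons_succ (k : ℕ) :
    singletons (k + 1) = (true :: (singletons k).map fun _ => false) ::
      (singletons k).map fun e => false :: e := by
  unfold singletons
  rw [List.ofFn_succ, List.ofFn_succ]
  congr 1
  · congr 1
    rw [List.map_ofFn]
    rfl
  · rw [List.map_ofFn]
    congr 1
    funext i
    rw [List.ofFn_succ]
    simp [(Fin.succ_ne_zero _).symm]

end Mask

theorem Enc.esize_list_le {α : Type*} [Enc α] {l : List α} {B : ℕ} (h : ∀ a ∈ l, esize a ≤ B) :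
    esize l ≤ l.length * (B + 1) + 1 := by
  induction l with
  | nil => simp [esize_nil]
  | cons a l ih =>
    have h₁ := ih fun a' ha' => h a' (List.mem_cons_of_mem _ ha')
    have h₂ := h a List.mem_cons_self
    simp only [esize_cons, List.length_cons, add_mul, one_mul] at *
    omega

theorem Enc.esize_mask_le (S : List Bool) : esize S ≤ 4 * S.length + 1 := by
  have := esize_list_le (l := S) (B := 3) fun b _ => esize_bool_le b
  omega

theorem Enc.esize_map_zip_le (S T : List Bool) (f : Bool × Bool → Bool) :
    esize ((S.zip T).map f) ≤ 4 * esize T + 1 := by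
  have h₁ := esize_mask_le ((S.zip T).map f)
  have h₂ := length_le_esize T
  simp only [List.length_map, List.length_zip] at h₁
  omega

theorem Enc.esize_updateFirst_le {α : Type*} [Enc α] {p : α → Bool} {f : α → α} {B : ℕ}
    (hf : ∀ a, esize (f a) ≤ B) (l : List α) : esize (l.updateFirst p f) ≤ esize l + B := by
  induction l with
  | nil => simp [List.updateFirst]
  | cons a l ih =>
    have := hf a
    simp only [List.updateFirst]
    split <;> simp only [esize_cons] <;> omega

namespace PT

variable {α γ : Type*} [Enc α] [Enc γ]

@[fun_prop]
theorem maskDiff {S T : γ → List Bool} (hS : PT S) (hT : PT T) :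
    PT fun c => Mask.diff (S c) (T c) := by
  unfold Mask.diff
  fun_prop

@[fun_prop]
theorem maskInter {S T : γ → List Bool} (hS : PT S) (hT : PT T) :
    PT fun c => Mask.inter (S c) (T c) := by
  unfold Mask.inter
  fun_prop

@[fun_prop]
theorem maskUnion {S T : γ → List Bool} (hS : PT S) (hT : PT T) :
    PT fun c => Mask.union (S c) (T c) := by
  unfold Mask.union
  fun_prop

@[fun_prop]
theorem maskOverlap {S T : γ → List Bool} (hS : PT S) (hT : PT T) :
    PT fun c => Mask.overlap (S c) (T c) := by
  unfold Mask.overlap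
  fun_prop

@[fun_prop]
theorem maskSingletons {l : γ → List α} (hl : PT l) :
    PT fun c => Mask.singletons (l c).length := by
  -- The list is a unary counter; each of its elements raises the dimension of the unit vectors by
  -- one.
  let f : γ → List (List Bool) → α → List (List Bool) := fun _ r _ =>
    (true :: r.map fun _ => false) :: r.map fun e => false :: e
  have key : ∀ c (l : List α) (k : ℕ),
      l.foldl (f c) (Mask.singletons k) = Mask.singletons (k + l.length) := by
    intro c l
    induction l with
    | nil => simp
    | cons a l ih =>
      intro k
      rw [List.foldl_cons]
      change l.foldl (f c) ((true :: (Mask.singletons k).map fun _ => false) ::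
        (Mask.singletons k).map fun e => false :: e) = _
      rw [← Mask.singletons_succ, ih, List.length_cons]
      congr 1
      omega
  have key₀ : ∀ c (l : List α), l.foldl (f c) [] = Mask.singletons l.length := fun c l => by
    have := key c l 0
    rwa [zero_add] at this
  have : PT fun c => (l c).foldl (f c) [] := by
    refine foldl_of_bound (by fun_prop) hl (const []) ?_
    have hlb := hl.size_bound.reindex fun j : γ × ℕ => j.1
    refine ((hlb.mul (((PolyBound.const 4).mul hlb).add (.const 2))).add (.const 1)).of_le
      fun j => ?_
    rw [key₀ j.1]
    have h₁ : ((l j.1).take j.2).length ≤ esize (l j.1) := by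
      rw [List.length_take]
      exact (min_le_right _ _).trans (length_le_esize _)
    set k := ((l j.1).take j.2).length
    have h₂ : esize (Mask.singletons k) ≤ k * (4 * k + 1 + 1) + 1 := by
      have := esize_list_le (l := Mask.singletons k) (B := 4 * k + 1) fun e he => by
        obtain ⟨i, rfl⟩ := (List.mem_ofFn' _ _).1 he
        simpa using esize_mask_le (List.ofFn fun j : Fin k => decide (j = i))
      simpa [Mask.singletons] using this
    have h₃ : k * (4 * k + 1 + 1) ≤ esize (l j.1) * (4 * esize (l j.1) + 2) :=
      Nat.mul_le_mul h₁ (by omega)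
    exact h₂.trans (Nat.add_le_add_right h₃ 1)
  convert this using 2 with c
  exact (key₀ c _).symm

end PT

/-! ### Values scaled to integers -/

/-- One step of adding up fractions without reducing them; only the selected ones count. -/
def fracStep (s : ℕ × ℕ) (x : (ℕ × ℕ) × Bool) : ℕ × ℕ :=
  (s.1 * x.1.2 + (if x.2 = true then x.1.1 else 0) * s.2, s.2 * x.1.2)

/-- The sum of the selected fractions, multiplied by the product of all denominators. -/
def scaledVal (r : List (ℕ × ℕ)) (S : List Bool) : ℕ := ((r.zip S).foldl fracStep (0, 1)).1

/-- Fractions stay short even without reduction: adding `a / b` raises the exponent of the bound by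
`a.size + b.size + 1`, and these increments sum to at most the size of the list. -/
theorem foldl_fracStep_lt (l : List ((ℕ × ℕ) × Bool)) (s : ℕ × ℕ) (k : ℕ) (h₁ : s.1 < 2 ^ k)
    (h₂ : s.2 < 2 ^ k) :
    (l.foldl fracStep s).1 < 2 ^ (k + esize l) ∧ (l.foldl fracStep s).2 < 2 ^ (k + esize l) := by
  induction l generalizing s k with
  | nil =>
    have : 2 ^ k ≤ 2 ^ (k + esize ([] : List ((ℕ × ℕ) × Bool))) :=
      Nat.pow_le_pow_right (by simp) (by omega)
    simp only [List.foldl_nil]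
    omega
  | cons x l ih =>
    obtain ⟨⟨a, b⟩, c⟩ := x
    have ha := Nat.lt_size_self a
    have hb := Nat.lt_size_self b
    have ha' := Nat.size_le_esize a
    have hb' := Nat.size_le_esize b
    have hc := esize_pos c
    have hk : k + a.size + b.size + 1 + esize l ≤ k + esize (((a, b), c) :: l) := by
      simp only [esize_cons, esize_pair]; omega
    have hmono : 2 ^ (k + a.size + b.size + 1 + esize l) ≤ 2 ^ (k + esize (((a, b), c) :: l)) :=
      Nat.pow_le_pow_right (by simp) hk
    have hA : 1 ≤ 2 ^ a.size := Nat.one_le_two_pow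
    have hB : 1 ≤ 2 ^ b.size := Nat.one_le_two_pow
    have hpow : 2 ^ (k + a.size + b.size + 1) = 2 ^ k * 2 ^ a.size * 2 ^ b.size * 2 := by
      rw [pow_succ, pow_add, pow_add]
    have hsb : ∀ z, z < 2 ^ k → z * b < 2 ^ k * 2 ^ a.size * 2 ^ b.size := fun z hz => by
      calc z * b < 2 ^ k * 2 ^ b.size := Nat.mul_lt_mul'' hz hb
        _ = 2 ^ k * 1 * 2 ^ b.size := by ring
        _ ≤ _ := by gcongr
    have hsa : (if c = true then a else 0) * s.2 < 2 ^ k * 2 ^ a.size * 2 ^ b.size := by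
      calc (if c = true then a else 0) * s.2 ≤ a * s.2 :=
            Nat.mul_le_mul_right _ (by split <;> simp)
        _ < 2 ^ a.size * 2 ^ k := Nat.mul_lt_mul'' ha h₂
        _ = 2 ^ k * 2 ^ a.size * 1 := by ring
        _ ≤ _ := by gcongr
    have := ih (fracStep s ((a, b), c)) (k + a.size + b.size + 1)
      (by have := hsb _ h₁; simp only [fracStep]; omega)
      (by have := hsb _ h₂; simp only [fracStep]; omega)
    rw [List.foldl_cons]
    omega

namespace PT

variable {γ : Type*} [Enc γ]

@[fun_prop]
theorem scaledVal_comp {r : γ → List (ℕ × ℕ)} {S : γ → List Bool} (hr : PT r) (hS : PT S) :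
    PT fun c => scaledVal (r c) (S c) := by
  have hl : PT fun c => (r c).zip (S c) := by fun_prop
  have hf : PT fun p : γ × (ℕ × ℕ) × (ℕ × ℕ) × Bool => fracStep p.2.1 p.2.2 := by
    unfold fracStep
    fun_prop
  refine fst (foldl_of_bound (f := fun _ s x => fracStep s x) hf hl (const (0, 1)) ?_)
  have hlb := hl.size_bound.reindex fun j : γ × ℕ => j.1
  refine (((PolyBound.const 8).mul ((PolyBound.const 1).add hlb)).add (.const 3)).of_le
    fun j => ?_
  set l := (r j.1).zip (S j.1)
  have h₀ : ∀ (k : ℕ) (l : List ((ℕ × ℕ) × Bool)), esize (l.take k) ≤ esize l := by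
    intro k
    induction k with
    | zero =>
      intro l
      have := esize_pos l
      simp only [List.take_zero, esize_nil]; omega
    | succ k ih =>
      rintro (_ | ⟨a, l⟩)
      · simp
      · have := ih l
        simp only [List.take_succ_cons, esize_cons]; omega
  have h₀ := h₀ j.2 l
  obtain ⟨h₁, h₂⟩ := foldl_fracStep_lt (l.take j.2) (0, 1) 1 (by simp) (by simp)
  rw [← Nat.size_le] at h₁ h₂
  set z := (l.take j.2).foldl fracStep (0, 1)
  have h₃ := esize_nat_le z.1
  have h₄ := esize_nat_le z.2
  have h₅ : esize z = esize z.1 + esize z.2 + 1 := rfl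
  omega

end PT

/-! ### The algorithm on lists -/

/-- An agent: the values of the items as fractions, a threshold, and the mask of a bundle. -/
abbrev Agent : Type := List (ℕ × ℕ) × ℕ × List Bool

namespace Agent

/-- The agent is not content with the bundle. -/
def wants (a : Agent) (S : List Bool) : Bool := decide (8 * scaledVal a.1 S < a.2.1)

def unsat (a : Agent) : Bool := a.wants a.2.2

/-- The agent is not content with its own bundle, but would be with `S`. -/
def happy (S : List Bool) (a : Agent) : Bool := a.unsat && !a.wants S

/-- The mask of the items in no bundle. -/
def free (m : ℕ) (l : List Agent) : List Bool :=
  (Mask.singletons m).map fun e => !l.any fun a => Mask.overlap a.2.2 e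

/-- Drop items from `S`, one at a time, as long as some agent would be happy with the rest. -/
def shrink (m : ℕ) (l : List Agent) (S : List Bool) : List Bool :=
  (Mask.singletons m).foldl (fun S e =>
    if (l.any (happy (Mask.diff S e))) = true then Mask.diff S e else S) S

/-- Halve the threshold of the first unsatisfied agent and take back all bundles. -/
def restart (l : List Agent) : List Agent :=
  (l.updateFirst unsat fun a => (a.1, a.2.1.div2, a.2.2)).map fun a =>
    (a.1, a.2.1, a.2.2.map fun _ => false)

/-- The recipient need not be the agent for whom the independent set was computed: after shrinking,
only another agent may still be happy. -/
def assign (S : List Bool) (l : List Agent) : List Agent :=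
  l.updateFirst (happy S) fun a => (a.1, a.2.1, S)

/-- The main loop never meets the default, because its body runs only while some agent is
unsatisfied. -/
def firstUnsat (l : List Agent) : Agent := (l.find? unsat).getD ([], 0, [])

/-- The weights passed to the independent set solver. -/
def query (m : ℕ) (l : List Agent) : List (ℕ × ℕ) :=
  -- `(0, 1)` is the reduced form of the weight 0, so the list is exactly the encoding of a vector
  -- of rationals.
  ((firstUnsat l).1.zip (free m l)).map fun x => if x.2 = true then x.1 else (0, 1)

/-- Use the free part of the independent set `S` found by the solver. -/
def step (m : ℕ) (l : List Agent) (S : List Bool) : List Agent :=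
  if ((firstUnsat l).wants (Mask.inter S (free m l))) = true then restart l
  else assign (shrink m l (Mask.inter S (free m l))) l

end Agent

/-- Put the items that are in no bundle, one at a time, into the first bundle without conflict. -/
def complete (g : List (List Bool)) (l : List (List Bool)) : List (List Bool) :=
  ((Mask.singletons g.length).zip g).foldl (fun l x =>
    if (l.any fun B => Mask.overlap B x.1) = true then l
    else l.updateFirst (fun B => !Mask.overlap B x.2) fun B => Mask.union B x.1) l

namespace PT

variable {γ : Type*} [Enc γ]

open Agent

@[fun_prop]
theorem wants_comp {a : γ → Agent} {S : γ → List Bool} (ha : PT a) (hS : PT S) :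
    PT fun c => (a c).wants (S c) := by
  unfold wants
  fun_prop

@[fun_prop]
theorem unsat_comp {a : γ → Agent} (ha : PT a) : PT fun c => (a c).unsat := by
  unfold unsat
  fun_prop

@[fun_prop]
theorem happy_comp {a : γ → Agent} {S : γ → List Bool} (ha : PT a) (hS : PT S) :
    PT fun c => happy (S c) (a c) := by
  unfold happy
  fun_prop

@[fun_prop]
theorem free_comp {α : Type*} [Enc α] {g : γ → List α} {l : γ → List Agent} (hg : PT g)
    (hl : PT l) : PT fun c => free (g c).length (l c) := by
  unfold free
  refine map (g := fun c e => !(l c).any fun a => Mask.overlap a.2.2 e) (not ?_) (by fun_prop)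
  exact any (p := fun (x : γ × List Bool) a => Mask.overlap a.2.2 x.2) (by fun_prop)
    (comp hl (f := Prod.fst) (by fun_prop))

@[fun_prop]
theorem shrink_comp {α : Type*} [Enc α] {g : γ → List α} {l : γ → List Agent}
    {S : γ → List Bool} (hg : PT g) (hl : PT l) (hS : PT S) :
    PT fun c => shrink (g c).length (l c) (S c) := by
  refine foldl (f := fun c S e =>
    if ((l c).any (happy (Mask.diff S e))) = true then Mask.diff S e else S) ?_ (by fun_prop) hS
    ⟨4 * .X + 1, fun c S e => ?_⟩
  · refine ite (any (p := fun (x : γ × List Bool × List Bool) a =>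
      happy (Mask.diff x.2.1 x.2.2) a) (by fun_prop) (comp hl (f := Prod.fst) (by fun_prop)))
      (by fun_prop) (by fun_prop)
  · have : esize (Mask.diff S e) ≤ 4 * esize e + 1 := esize_map_zip_le S e _
    have h₄ : ∀ n : ℕ, (4 : Polynomial ℕ).eval n = 4 := fun n => by simp
    simp only [Polynomial.eval_add, Polynomial.eval_mul, Polynomial.eval_X,
      Polynomial.eval_one, h₄]
    split <;> omega

@[fun_prop]
theorem restart_comp {l : γ → List Agent} (hl : PT l) : PT fun c => restart (l c) := by
  have := updateFirst (p := fun _ : γ => unsat) (f := fun _ a => (a.1, a.2.1.div2, a.2.2))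
    (by fun_prop) (by fun_prop) hl
  unfold restart
  fun_prop

@[fun_prop]
theorem assign_comp {S : γ → List Bool} {l : γ → List Agent} (hS : PT S) (hl : PT l) :
    PT fun c => assign (S c) (l c) :=
  updateFirst (p := fun c a => happy (S c) a) (f := fun c a => (a.1, a.2.1, S c))
    (happy_comp (by fun_prop) (comp hS (f := Prod.fst) (by fun_prop)))
    (prodMk (by fun_prop) (prodMk (by fun_prop) (comp hS (f := Prod.fst) (by fun_prop)))) hl

@[fun_prop]
theorem firstUnsat_comp {l : γ → List Agent} (hl : PT l) : PT fun c => firstUnsat (l c) :=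
  findD (p := fun _ => unsat) (by fun_prop) hl (const _)

@[fun_prop]
theorem query_comp {α : Type*} [Enc α] {g : γ → List α} {l : γ → List Agent} (hg : PT g)
    (hl : PT l) : PT fun c => query (g c).length (l c) := by
  unfold query
  fun_prop

@[fun_prop]
theorem step_comp {α : Type*} [Enc α] {g : γ → List α} {l : γ → List Agent}
    {S : γ → List Bool} (hg : PT g) (hl : PT l) (hS : PT S) :
    PT fun c => step (g c).length (l c) (S c) := by
  unfold step
  fun_prop

theorem complete_comp {g l : γ → List (List Bool)} (hg : PT g) (hl : PT l) :
    PT fun c => complete (g c) (l c) := by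
  refine foldl (f := fun _ l (x : List Bool × List Bool) => if (l.any fun B => Mask.overlap B x.1) = true then l
    else l.updateFirst (fun B => !Mask.overlap B x.2) fun B => Mask.union B x.1) ?_
    (by fun_prop) hl ⟨4 * .X + 1, fun c l x => ?_⟩
  · refine ite (any (p := fun (x : γ × List (List Bool) × List Bool × List Bool) B =>
      Mask.overlap B x.2.2.1) (by fun_prop) (by fun_prop)) (by fun_prop) ?_
    exact updateFirst (p := fun (x : γ × List (List Bool) × List Bool × List Bool) B =>
      !Mask.overlap B x.2.2.2) (f := fun x B => Mask.union B x.2.2.1) (by fun_prop)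
      (by fun_prop) (by fun_prop)
  · have := esize_updateFirst_le (p := fun B => !Mask.overlap B x.2)
      (f := fun B => Mask.union B x.1) (fun B => esize_map_zip_le B x.1 _) l
    have h₁ : esize x = esize x.1 + esize x.2 + 1 := rfl
    have h₄ : ∀ n : ℕ, (4 : Polynomial ℕ).eval n = 4 := fun n => by simp
    simp only [Polynomial.eval_add, Polynomial.eval_mul, Polynomial.eval_X,
      Polynomial.eval_one, h₄]
    split <;> omega

end PT

/-! ### Bag filling -/

namespace BagFilling

variable {n m : ℕ}

/-- The integer value of a bundle. -/
abbrev val (w : Fin n → Fin m → ℕ) (i : Fin n) (S : Finset (Fin m)) : ℕ := ∑ j ∈ S, w i j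

/-- Agent `i` is not content with its bundle, at threshold `θ i`. -/
def Unsat (w : Fin n → Fin m → ℕ) (θ : Fin n → ℕ) (A : Fin n → Finset (Fin m)) (i : Fin n) :
    Prop := 8 * val w i (A i) < θ i

/-- The items in no bundle. -/
def free (A : Fin n → Finset (Fin m)) : Finset (Fin m) := Finset.univ.filter fun j => ∀ i, j ∉ A i

theorem mem_free {A : Fin n → Finset (Fin m)} {j : Fin m} : j ∈ free A ↔ ∀ i, j ∉ A i := by
  simp [free]

/-- Complete allocations into independent bundles. -/
def Feasible (G : SimpleGraph (Fin m)) (A : Fin n → Finset (Fin m)) : Prop :=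
  (∀ j, ∃! i, j ∈ A i) ∧ ∀ i, G.IsIndepSet (A i : Set (Fin m))

/-- The invariant of the main loop. -/
structure Inv (G : SimpleGraph (Fin m)) (w : Fin n → Fin m → ℕ) (θ : Fin n → ℕ)
    (A : Fin n → Finset (Fin m)) : Prop where
  disjoint : ∀ j i i', j ∈ A i → j ∈ A i' → i = i'
  indep : ∀ i, G.IsIndepSet (A i : Set (Fin m))
  eq_empty : ∀ i, Unsat w θ A i → A i = ∅
  small : ∀ i, Unsat w θ A i → ∀ l, (A l).card ≤ 1 ∨ 8 * val w i (A l) < 2 * θ i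
  -- That is, `θ i` is an upper bound for the maximin share with respect to `w i`.
  share_le : ∀ i Q, Feasible (n := n) G Q → ∃ k, val w i (Q k) ≤ θ i

variable {G : SimpleGraph (Fin m)} {w : Fin n → Fin m → ℕ} {θ : Fin n → ℕ}
  {A : Fin n → Finset (Fin m)}

theorem inv_empty (h : ∀ i Q, Feasible (n := n) G Q → ∃ k, val w i (Q k) ≤ θ i) :
    Inv G w θ fun _ => ∅ where
  disjoint := by simp
  indep := by simp [SimpleGraph.isIndepSet_iff]
  eq_empty := by simp
  small := by simp
  share_le := h

/-- If the free items contain no independent set that is worth an eighth of the threshold, then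
the threshold is larger than the maximin share by a factor of at least two. -/
theorem Inv.exists_val_le (h : Inv G w θ A) {i : Fin n} (hi : Unsat w θ A i)
    (hfree : ∀ T ⊆ free A, G.IsIndepSet (T : Set (Fin m)) → 8 * val w i T < θ i)
    {Q : Fin n → Finset (Fin m)} (hQ : Feasible G Q) : ∃ k, val w i (Q k) ≤ θ i / 2 := by
  classical
  by_contra! hbig
  obtain ⟨hpart, hind⟩ := hQ
  choose b hb hb' using hpart
  let Sg : Finset (Fin n) := Finset.univ.filter fun l => (A l).card = 1
  let L : Finset (Fin n) := Finset.univ.filter fun l => 1 < (A l).card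
  -- The bundles of `Q` that avoid all singletons of `A`. The item of a singleton lies in one bundle
  -- of `Q`, so at most `Sg.card` bundles are lost.
  let K : Finset (Fin n) := Finset.univ.filter fun k => ∀ l ∈ Sg, ∀ j ∈ A l, j ∉ Q k
  have hK : n ≤ K.card + Sg.card := by
    have hcompl : Kᶜ.card ≤ Sg.card := by
      have : Kᶜ ⊆ (Sg.biUnion A).image b := by
        intro k hk
        simp only [K, Finset.mem_compl, Finset.mem_filter, Finset.mem_univ, true_and] at hk
        push Not at hk
        obtain ⟨l, hl, j, hj, hjk⟩ := hk
        exact Finset.mem_image.2 ⟨j, Finset.mem_biUnion.2 ⟨l, hl, hj⟩, (hb' j k hjk).symm⟩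
      refine (Finset.card_le_card this).trans (Finset.card_image_le.trans ?_)
      refine (Finset.card_biUnion_le_card_mul _ _ 1 fun l hl => ?_).trans (by simp)
      simp only [Sg, Finset.mem_filter] at hl
      exact hl.2.le
    have := Finset.card_add_card_compl K
    simp only [Fintype.card_fin] at this
    omega
  -- The empty bundle of `i` accounts for the extra 1; together with `hK` this gives `L.card <
  -- K.card`.
  have hL : L.card + Sg.card + 1 ≤ n := by
    have h₁ : Disjoint L Sg := by
      rw [Finset.disjoint_left]
      intro l hl hl'
      simp only [L, Sg, Finset.mem_filter] at hl hl'
      omega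
    have h₂ : i ∉ L ∪ Sg := by
      simp [L, Sg, h.eq_empty i hi]
    have := Finset.card_le_univ (insert i (L ∪ Sg))
    rw [Finset.card_insert_of_notMem h₂, Finset.card_union_of_disjoint h₁, Fintype.card_fin]
      at this
    exact this
  -- An item of such a bundle is free or belongs to a bundle of `A` with at least two items.
  have hcover : ∀ k ∈ K, val w i (Q k) ≤
      val w i (Q k ∩ free A) + ∑ l ∈ L, val w i (Q k ∩ A l) := by
    intro k hk
    have hsub : Q k ⊆ (Q k ∩ free A) ∪ L.biUnion fun l => Q k ∩ A l := by
      intro j hj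
      by_cases hjf : j ∈ free A
      · exact Finset.mem_union_left _ (Finset.mem_inter.2 ⟨hj, hjf⟩)
      · rw [mem_free] at hjf
        push Not at hjf
        obtain ⟨l, hl⟩ := hjf
        refine Finset.mem_union_right _ (Finset.mem_biUnion.2 ⟨l, ?_, Finset.mem_inter.2 ⟨hj, hl⟩⟩)
        have h₁ : (A l).card ≠ 1 := fun hc => by
          simp only [K, Finset.mem_filter] at hk
          exact hk.2 l (by simp [Sg, hc]) j hl hj
        have h₂ : 0 < (A l).card := Finset.card_pos.2 ⟨j, hl⟩
        simp only [L, Finset.mem_filter, Finset.mem_univ, true_and]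
        omega
    refine (Finset.sum_le_sum_of_subset hsub).trans ?_
    rw [← Finset.sum_biUnion]
    · exact (Nat.le_add_right _ _).trans (Finset.sum_union_inter (f := w i)).le
    · intro l _ l' _ hne
      rw [Function.onFun, Finset.disjoint_left]
      intro j hj hj'
      rw [Finset.mem_inter] at hj hj'
      exact hne (h.disjoint j l l' hj.2 hj'.2)
  have hdisj : ∀ l, ∑ k ∈ K, val w i (Q k ∩ A l) ≤ val w i (A l) := by
    intro l
    rw [← Finset.sum_biUnion]
    · refine Finset.sum_le_sum_of_subset ?_
      intro j hj
      simp only [Finset.mem_biUnion, Finset.mem_inter] at hj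
      obtain ⟨_, _, _, hj⟩ := hj
      exact hj
    · intro k _ k' _ hne
      rw [Function.onFun, Finset.disjoint_left]
      intro j hj hj'
      rw [Finset.mem_inter] at hj hj'
      exact hne ((hb' j k hj.1).trans (hb' j k' hj'.1).symm)
  have h₁ : ∑ k ∈ K, 8 * val w i (Q k) ≤ ∑ k ∈ K, 8 * val w i (Q k ∩ free A) +
      ∑ l ∈ L, 8 * val w i (A l) := by
    simp only [← Finset.mul_sum, ← mul_add]
    refine Nat.mul_le_mul_left 8 ((Finset.sum_le_sum hcover).trans ?_)
    rw [Finset.sum_add_distrib, Finset.sum_comm]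
    exact Nat.add_le_add_left (Finset.sum_le_sum fun l _ => hdisj l) _
  have hKne : K.Nonempty := Finset.card_pos.1 (by omega)
  have h₂ : ∑ k ∈ K, 8 * val w i (Q k ∩ free A) < K.card * θ i := by
    rw [← smul_eq_mul, ← Finset.sum_const]
    exact Finset.sum_lt_sum_of_nonempty hKne fun k _ => hfree _ Finset.inter_subset_right
      ((hind k).mono (by simp))
  have h₃ : ∑ l ∈ L, 8 * val w i (A l) ≤ L.card * (2 * θ i) := by
    rw [← smul_eq_mul, ← Finset.sum_const]
    refine Finset.sum_le_sum fun l hl => ?_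
    simp only [L, Finset.mem_filter] at hl
    rcases h.small i hi l with h' | h'
    · omega
    · exact h'.le
  -- Despite the rounding in `θ i / 2`, the assumption `hbig` would even give the factor 4; the
  -- factor 3 already contradicts `h₂` and `h₃`.
  have h₄ : K.card * (3 * θ i) ≤ ∑ k ∈ K, 8 * val w i (Q k) := by
    rw [← smul_eq_mul, ← Finset.sum_const]
    refine Finset.sum_le_sum fun k _ => ?_
    have := hbig k
    omega
  have h₅ : L.card * (2 * θ i) ≤ K.card * (2 * θ i) := Nat.mul_le_mul_right _ (by omega)
  have h₆ : K.card * (3 * θ i) = K.card * θ i + K.card * (2 * θ i) := by ring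
  omega

theorem Inv.restart (h : Inv G w θ A) {i : Fin n} (hi : Unsat w θ A i)
    (hfree : ∀ T ⊆ free A, G.IsIndepSet (T : Set (Fin m)) → 8 * val w i T < θ i) :
    Inv G w (Function.update θ i (θ i / 2)) fun _ => ∅ := by
  refine inv_empty fun i' Q hQ => ?_
  by_cases hii : i' = i
  · subst hii
    simpa using h.exists_val_le hi hfree hQ
  · simpa [hii] using h.share_le i' Q hQ

theorem unsat_update {k i : Fin n} {S : Finset (Fin m)} (hk : θ k ≤ 8 * val w k S)
    (hi : Unsat w θ (Function.update A k S) i) : i ≠ k ∧ Unsat w θ A i := by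
  by_cases hik : i = k
  · subst hik
    simp only [Unsat, Function.update_self] at hi
    omega
  · exact ⟨hik, by simpa [Unsat, hik] using hi⟩

theorem Inv.assign (h : Inv G w θ A) {k : Fin n} {S : Finset (Fin m)} (hS : S ⊆ free A)
    (hind : G.IsIndepSet (S : Set (Fin m))) (hk : Unsat w θ A k) (hkS : θ k ≤ 8 * val w k S)
    (hmin : ∀ j ∈ S, ∀ i, Unsat w θ A i → 8 * val w i (S.erase j) < θ i) :
    Inv G w θ (Function.update A k S) where
  disjoint := by
    intro j i i' hi hi'
    by_cases hik : i = k <;> by_cases hik' : i' = k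
    · rw [hik, hik']
    · subst hik
      simp only [Function.update_self, Function.update_of_ne hik'] at hi hi'
      exact absurd hi' (mem_free.1 (hS hi) i')
    · subst hik'
      simp only [Function.update_self, Function.update_of_ne hik] at hi hi'
      exact absurd hi (mem_free.1 (hS hi') i)
    · simp only [Function.update_of_ne hik, Function.update_of_ne hik'] at hi hi'
      exact h.disjoint j i i' hi hi'
  indep := by
    intro i
    by_cases hik : i = k
    · subst hik; simpa using hind
    · simpa [hik] using h.indep i
  eq_empty := by
    intro i hi
    obtain ⟨hik, hi⟩ := unsat_update hkS hi
    simpa [hik] using h.eq_empty i hi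
  small := by
    intro i hi' l
    have hi := (unsat_update hkS hi').2
    by_cases hlk : l = k
    · subst hlk
      rw [Function.update_self, or_iff_not_imp_left, not_le]
      intro hc
      -- By minimality `S.erase a` is worth less than an eighth of the threshold, and so is `a`
      -- itself, as it lies in `S.erase b`. This is the source of the factor 2 in `small`.
      obtain ⟨a, ha, b, hb, hab⟩ := Finset.one_lt_card.1 hc
      have h₁ := hmin a ha i hi
      have h₂ := hmin b hb i hi
      have h₃ : w i a ≤ val w i (S.erase b) :=
        Finset.single_le_sum (f := w i) (fun _ _ => Nat.zero_le _)
          (Finset.mem_erase.2 ⟨hab, ha⟩)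
      have h₄ : val w i (S.erase a) + w i a = val w i S := Finset.sum_erase_add _ _ ha
      omega
    · simpa [hlk] using h.small i hi l
  share_le := h.share_le

open Classical in
/-- The measure that bounds the number of iterations. -/
def measure (w : Fin n → Fin m → ℕ) (θ : Fin n → ℕ) (A : Fin n → Finset (Fin m)) : ℕ :=
  -- The weight `n + 1` lets the loss of one bit outweigh the at most `n` agents left unsatisfied by
  -- a restart.
  (n + 1) * (∑ i, (θ i).size) + (Finset.univ.filter fun i => Unsat w θ A i).card

theorem measure_restart {A' : Fin n → Finset (Fin m)} {i : Fin n} (hi : Unsat w θ A i) :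
    measure w (Function.update θ i (θ i / 2)) A' < measure w θ A := by
  classical
  unfold measure
  have h₁ : (Finset.univ.filter fun j => Unsat w (Function.update θ i (θ i / 2)) A' j).card ≤ n :=
    (Finset.card_le_univ _).trans (by simp)
  have h₂ : ∑ j, (Function.update θ i (θ i / 2) j).size < ∑ j, (θ j).size := by
    refine Finset.sum_lt_sum (fun j _ => ?_) ⟨i, Finset.mem_univ _, ?_⟩
    · by_cases hj : j = i
      · subst hj
        rw [Function.update_self]
        exact Nat.size_le_size (Nat.div_le_self _ _)
      · rw [Function.update_of_ne hj]
    · rw [Function.update_self]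
      -- An agent with threshold 0 is always satisfied, so there is a bit to lose.
      have h₀ : θ i ≠ 0 := by unfold Unsat at hi; omega
      have h₃ : 0 < (θ i).size := Nat.size_pos.2 (by omega)
      have h₄ : (θ i / 2).size ≤ (θ i).size - 1 := by
        rw [Nat.size_le]
        have h₅ := Nat.lt_size_self (θ i)
        obtain ⟨s, hs⟩ : ∃ s, (θ i).size = s + 1 := ⟨_, (Nat.succ_pred_eq_of_pos h₃).symm⟩
        rw [hs, pow_succ] at h₅
        rw [hs, Nat.add_sub_cancel]
        omega
      omega
  have h₃ := Nat.mul_le_mul_left (n + 1) (Nat.succ_le_of_lt h₂)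
  rw [Nat.succ_eq_add_one, mul_add] at h₃
  omega

theorem measure_assign {k : Fin n} {S : Finset (Fin m)} (hk : Unsat w θ A k)
    (hkS : θ k ≤ 8 * val w k S) : measure w θ (Function.update A k S) < measure w θ A := by
  classical
  unfold measure
  refine Nat.add_lt_add_left (Finset.card_lt_card ?_) _
  rw [Finset.ssubset_iff_of_subset]
  · refine ⟨k, by simpa using hk, ?_⟩
    intro hk'
    exact (unsat_update hkS (Finset.mem_filter.1 hk').2).1 rfl
  · intro i hi
    simp only [Finset.mem_filter, Finset.mem_univ, true_and] at hi ⊢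
    exact (unsat_update hkS hi).2

end BagFilling

/-! ### The list operations in terms of finite sets -/

theorem List.zip_ofFn_ofFn {α β : Type*} {k : ℕ} (f : Fin k → α) (g : Fin k → β) :
    (List.ofFn f).zip (List.ofFn g) = List.ofFn fun i => (f i, g i) := by
  apply List.ext_getElem <;> simp

theorem List.any_ofFn {α : Type*} {k : ℕ} (f : Fin k → α) (p : α → Bool) :
    (List.ofFn f).any p = true ↔ ∃ i, p (f i) = true := by
  simp [List.any_eq_true]

/-- The first element of the list that satisfies `p`, and its replacement. -/
theorem List.exists_find?_updateFirst_ofFn {α : Type*} {k : ℕ} (f : Fin k → α) (p : α → Bool)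
    (h : ∃ i, p (f i) = true) :
    ∃ i, p (f i) = true ∧ (List.ofFn f).find? p = some (f i) ∧ ∀ g : α → α,
      (List.ofFn f).updateFirst p g = List.ofFn (Function.update f i (g (f i))) := by
  induction k with
  | zero => exact h.choose.elim0
  | succ k ih =>
    rw [List.ofFn_succ]
    by_cases h₀ : p (f 0) = true
    · refine ⟨0, h₀, by simp [h₀], fun g => ?_⟩
      rw [List.updateFirst, if_pos h₀, List.ofFn_succ]
      simp [Fin.succ_ne_zero]
    · obtain ⟨i, hi⟩ := h
      obtain ⟨j, rfl⟩ : ∃ j : Fin k, i = j.succ :=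
        Fin.exists_succ_eq.2 (fun hi0 => h₀ (hi0 ▸ hi)) |>.imp fun _ h => h.symm
      obtain ⟨i, hi, hfind, hupd⟩ := ih (fun i => f i.succ) ⟨j, hi⟩
      refine ⟨i.succ, hi, by simp [h₀, hfind], fun g => ?_⟩
      rw [List.updateFirst, if_neg h₀, hupd, List.ofFn_succ]
      congr 1
      · congr 1
        funext j
        by_cases hj : j = i
        · subst hj; simp
        · simp [hj]

namespace Mask

variable {m : ℕ}

/-- Characteristic vector of a set. -/
def ofSet (S : Finset (Fin m)) : List Bool := List.ofFn fun j => decide (j ∈ S)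

theorem diff_ofSet (S T : Finset (Fin m)) : diff (ofSet S) (ofSet T) = ofSet (S \ T) := by
  simp only [diff, ofSet, List.zip_ofFn_ofFn, List.map_ofFn]
  congr 1
  funext j
  simp

theorem inter_ofSet (S T : Finset (Fin m)) : inter (ofSet S) (ofSet T) = ofSet (S ∩ T) := by
  simp only [inter, ofSet, List.zip_ofFn_ofFn, List.map_ofFn]
  congr 1
  funext j
  simp

theorem union_ofSet (S T : Finset (Fin m)) : union (ofSet S) (ofSet T) = ofSet (S ∪ T) := by
  simp only [union, ofSet, List.zip_ofFn_ofFn, List.map_ofFn]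
  congr 1
  funext j
  simp

theorem overlap_ofSet (S T : Finset (Fin m)) :
    overlap (ofSet S) (ofSet T) = true ↔ ∃ j ∈ S, j ∈ T := by
  simp only [overlap, ofSet, List.zip_ofFn_ofFn, List.any_ofFn]
  simp

theorem singletons_eq : singletons m = List.ofFn fun j : Fin m => ofSet {j} := by
  simp [singletons, ofSet]

theorem map_false_ofSet (S : Finset (Fin m)) : (ofSet S).map (fun _ => false) = ofSet (m := m) ∅ := by
  simp only [ofSet, List.map_ofFn]
  congr 1

end Mask

/-! ### The scaled value -/

/-- Unselected items contribute their denominators too. So the scaling factor of a row is the same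
for all bundles, and scaled values can be compared. -/
theorem foldl_fracStep_spec (l : List ((ℕ × ℕ) × Bool)) (s : ℕ × ℕ) (hs : s.2 ≠ 0)
    (hl : ∀ x ∈ l, x.1.2 ≠ 0) :
    (l.foldl fracStep s).2 = s.2 * (l.map fun x => x.1.2).prod ∧
    ((l.foldl fracStep s).1 : ℚ≥0) / (l.foldl fracStep s).2 =
      s.1 / s.2 + (l.map fun x => if x.2 = true then (x.1.1 : ℚ≥0) / x.1.2 else 0).sum := by
  induction l generalizing s with
  | nil => simp
  | cons x l ih =>
    have hx := hl x List.mem_cons_self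
    obtain ⟨h₁, h₂⟩ := ih (fracStep s x) (mul_ne_zero hs hx)
      fun y hy => hl y (List.mem_cons_of_mem _ hy)
    rw [List.foldl_cons, h₁, ← h₁, h₂, h₁]
    refine ⟨by simp [fracStep, mul_assoc], ?_⟩
    have hs' : (s.2 : ℚ≥0) ≠ 0 := by exact_mod_cast hs
    have hx' : (x.1.2 : ℚ≥0) ≠ 0 := by exact_mod_cast hx
    rw [List.map_cons, List.sum_cons, ← add_assoc]
    congr 1
    obtain ⟨⟨a, b⟩, c⟩ := x
    cases c <;> simp [fracStep] <;> field_simp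

/-- A row of values as a list of fractions. -/
def fracRow {m : ℕ} (v : Fin m → ℚ≥0) : List (ℕ × ℕ) := List.ofFn fun j => ((v j).num, (v j).den)

def denProd {m : ℕ} (v : Fin m → ℚ≥0) : ℕ := ∏ j, (v j).den

theorem denProd_pos {m : ℕ} (v : Fin m → ℚ≥0) : 0 < denProd v :=
  Finset.prod_pos fun j _ => (v j).den_pos

theorem scaledVal_fracRow {m : ℕ} (v : Fin m → ℚ≥0) (S : Finset (Fin m)) :
    (scaledVal (fracRow v) (Mask.ofSet S) : ℚ≥0) = denProd v * ∑ j ∈ S, v j := by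
  have hl : (fracRow v).zip (Mask.ofSet S) =
      List.ofFn fun j => (((v j).num, (v j).den), decide (j ∈ S)) := List.zip_ofFn_ofFn _ _
  obtain ⟨h₁, h₂⟩ := foldl_fracStep_spec ((fracRow v).zip (Mask.ofSet S)) (0, 1) one_ne_zero
    (by rw [hl]; simp)
  unfold scaledVal
  rw [hl] at h₁ h₂ ⊢
  simp only [List.map_ofFn, List.prod_ofFn, List.sum_ofFn, one_mul, Function.comp_apply] at h₁ h₂
  rw [h₁, div_eq_iff (by exact_mod_cast (denProd_pos v).ne')] at h₂
  rw [h₂, mul_comm]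
  congr 1
  simp [NNRat.num_div_den]

/-- The value of a single item, multiplied by all denominators of the row. -/
def scaledWeight {m : ℕ} (v : Fin m → ℚ≥0) (j : Fin m) : ℕ :=
  scaledVal (fracRow v) (Mask.ofSet {j})

theorem scaledWeight_cast {m : ℕ} (v : Fin m → ℚ≥0) (j : Fin m) :
    (scaledWeight v j : ℚ≥0) = denProd v * v j := by
  rw [scaledWeight, scaledVal_fracRow, Finset.sum_singleton]

theorem scaledVal_eq_sum {m : ℕ} (v : Fin m → ℚ≥0) (S : Finset (Fin m)) :
    scaledVal (fracRow v) (Mask.ofSet S) = ∑ j ∈ S, scaledWeight v j := by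
  have : (scaledVal (fracRow v) (Mask.ofSet S) : ℚ≥0) = ∑ j ∈ S, (scaledWeight v j : ℚ≥0) := by
    simp_rw [scaledVal_fracRow, scaledWeight_cast, Finset.mul_sum]
  exact_mod_cast this

/-! ### One iteration of the main loop -/

namespace BagFilling

variable {n m : ℕ}

/-- The list of agents in a given state. -/
def agents (v : Fin n → Fin m → ℚ≥0) (θ : Fin n → ℕ) (A : Fin n → Finset (Fin m)) : List Agent :=
  List.ofFn fun i => (fracRow (v i), θ i, Mask.ofSet (A i))

/-- The scaled weights of all agents. -/
abbrev weights (v : Fin n → Fin m → ℚ≥0) : Fin n → Fin m → ℕ := fun i => scaledWeight (v i)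

variable {G : SimpleGraph (Fin m)} {v : Fin n → Fin m → ℚ≥0} {θ : Fin n → ℕ}
  {A : Fin n → Finset (Fin m)}

theorem wants_iff (i : Fin n) (t : ℕ) (M : List Bool) (S : Finset (Fin m)) :
    Agent.wants (fracRow (v i), t, M) (Mask.ofSet S) = true ↔ 8 * val (weights v) i S < t := by
  simp [Agent.wants, scaledVal_eq_sum]

theorem unsat_iff (i : Fin n) :
    Agent.unsat (fracRow (v i), θ i, Mask.ofSet (A i)) = true ↔ Unsat (weights v) θ A i :=
  wants_iff i (θ i) _ (A i)

theorem happy_iff (i : Fin n) (S : Finset (Fin m)) :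
    Agent.happy (Mask.ofSet S) (fracRow (v i), θ i, Mask.ofSet (A i)) = true ↔
      Unsat (weights v) θ A i ∧ θ i ≤ 8 * val (weights v) i S := by
  rw [Agent.happy, Bool.and_eq_true, unsat_iff, Bool.not_eq_true', ← Bool.not_eq_true, wants_iff,
    not_lt]

theorem any_unsat_iff :
    (agents v θ A).any Agent.unsat = true ↔ ∃ i, Unsat (weights v) θ A i := by
  rw [agents, List.any_ofFn]
  exact exists_congr fun i => unsat_iff i

theorem any_happy_iff (S : Finset (Fin m)) :
    (agents v θ A).any (Agent.happy (Mask.ofSet S)) = true ↔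
      ∃ i, Unsat (weights v) θ A i ∧ θ i ≤ 8 * val (weights v) i S := by
  rw [agents, List.any_ofFn]
  exact exists_congr fun i => happy_iff i S

theorem free_agents : Agent.free m (agents v θ A) = Mask.ofSet (free A) := by
  rw [Agent.free, Mask.singletons_eq, List.map_ofFn, Mask.ofSet]
  congr 1
  funext j
  rw [Function.comp_apply, Bool.eq_iff_iff, Bool.not_eq_true', ← Bool.not_eq_true, agents,
    List.any_ofFn]
  simp [Mask.overlap_ofSet, mem_free]

/-- One pass over the items yields a minimal set: if `a` cannot be dropped from the current set,
then by monotonicity it cannot be dropped from any later subset. -/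
theorem shrink_agents (S : Finset (Fin m))
    (hS : ∃ i, Unsat (weights v) θ A i ∧ θ i ≤ 8 * val (weights v) i S) :
    ∃ S' ⊆ S, Agent.shrink m (agents v θ A) (Mask.ofSet S) = Mask.ofSet S' ∧
      (∃ i, Unsat (weights v) θ A i ∧ θ i ≤ 8 * val (weights v) i S') ∧
      ∀ j ∈ S', ∀ i, Unsat (weights v) θ A i → 8 * val (weights v) i (S'.erase j) < θ i := by
  have key : ∀ (L : List (Fin m)) (S : Finset (Fin m)),
      (∃ i, Unsat (weights v) θ A i ∧ θ i ≤ 8 * val (weights v) i S) →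
      ∃ S' ⊆ S, (L.map fun j => Mask.ofSet {j}).foldl (fun S e =>
          if ((agents v θ A).any (Agent.happy (Mask.diff S e))) = true then Mask.diff S e else S)
          (Mask.ofSet S) = Mask.ofSet S' ∧
        (∃ i, Unsat (weights v) θ A i ∧ θ i ≤ 8 * val (weights v) i S') ∧
        ∀ j ∈ L, j ∈ S' → ∀ i, Unsat (weights v) θ A i →
          8 * val (weights v) i (S'.erase j) < θ i := by
    intro L
    induction L with
    | nil => exact fun S hS => ⟨S, subset_rfl, rfl, hS, by simp⟩
    | cons a L ih =>
      intro S hS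
      rw [List.map_cons, List.foldl_cons, Mask.diff_ofSet]
      by_cases h : ∃ i, Unsat (weights v) θ A i ∧ θ i ≤ 8 * val (weights v) i (S \ {a})
      · rw [if_pos ((any_happy_iff _).2 h)]
        obtain ⟨S', hsub, heq, hex, hmin⟩ := ih _ h
        refine ⟨S', hsub.trans Finset.sdiff_subset, heq, hex, fun j hj hjS => ?_⟩
        rcases List.mem_cons.1 hj with rfl | hj
        · exact absurd (hsub hjS) (by simp)
        · exact hmin j hj hjS
      · rw [if_neg (mt (any_happy_iff _).1 h)]
        obtain ⟨S', hsub, heq, hex, hmin⟩ := ih _ hS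
        refine ⟨S', hsub, heq, hex, fun j hj hjS => ?_⟩
        rcases List.mem_cons.1 hj with rfl | hj
        · intro i hi
          push Not at h
          refine lt_of_le_of_lt (Nat.mul_le_mul_left 8 (Finset.sum_le_sum_of_subset ?_)) (h i hi)
          rw [Finset.sdiff_singleton_eq_erase]
          exact Finset.erase_subset_erase _ hsub
        · exact hmin j hj hjS
  obtain ⟨S', hsub, heq, hex, hmin⟩ := key (List.finRange m) S hS
  refine ⟨S', hsub, ?_, hex, fun j hj => hmin j (List.mem_finRange j) hj⟩
  rw [Agent.shrink, Mask.singletons_eq, List.ofFn_eq_map, heq]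

theorem agents_update_threshold (i : Fin n) (t : ℕ) :
    List.ofFn (Function.update (fun i => ((fracRow (v i), θ i, Mask.ofSet (A i)) : Agent)) i
      (fracRow (v i), t, Mask.ofSet (A i))) = agents v (Function.update θ i t) A := by
  rw [agents]
  congr 1
  funext k
  by_cases hk : k = i
  · subst hk; simp
  · simp [hk]

theorem agents_update_bundle (i : Fin n) (S : Finset (Fin m)) :
    List.ofFn (Function.update (fun i => ((fracRow (v i), θ i, Mask.ofSet (A i)) : Agent)) i
      (fracRow (v i), θ i, Mask.ofSet S)) = agents v θ (Function.update A i S) := by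
  rw [agents]
  congr 1
  funext k
  by_cases hk : k = i
  · subst hk; simp
  · simp [hk]

/-- One iteration: the query and the effect of a correct answer. -/
theorem Inv.step (h : Inv G (weights v) θ A) (hun : ∃ i, Unsat (weights v) θ A i) :
    ∃ u : Fin m → ℚ≥0, Agent.query m (agents v θ A) = fracRow u ∧
      ∀ S : Finset (Fin m), G.IsIndepSet (S : Set (Fin m)) →
        (∀ T : Finset (Fin m), G.IsIndepSet (T : Set (Fin m)) → ∑ j ∈ T, u j ≤ ∑ j ∈ S, u j) →
        ∃ θ' A', Agent.step m (agents v θ A) (Mask.ofSet S) = agents v θ' A' ∧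
          Inv G (weights v) θ' A' ∧
          measure (weights v) θ' A' < measure (weights v) θ A ∧ ∀ i, θ' i ≤ θ i := by
  obtain ⟨i, hi, hfind, hupd⟩ := List.exists_find?_updateFirst_ofFn
    (fun i => ((fracRow (v i), θ i, Mask.ofSet (A i)) : Agent)) Agent.unsat
    (hun.imp fun i hi => (unsat_iff i).2 hi)
  rw [unsat_iff] at hi
  have hfirst : Agent.firstUnsat (agents v θ A) = (fracRow (v i), θ i, Mask.ofSet (A i)) := by
    rw [Agent.firstUnsat, agents, hfind]
    rfl
  refine ⟨fun j => if j ∈ free A then v i j else 0, ?_, ?_⟩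
  · rw [Agent.query, hfirst, free_agents]
    simp only [fracRow, Mask.ofSet, List.zip_ofFn_ofFn, List.map_ofFn]
    congr 1
    funext j
    by_cases hj : j ∈ free A <;> simp [hj]
  · intro S hS hmax
    -- The weights vanish outside the free items, so the free part of `S` is optimal among the
    -- independent sets of free items.
    have hmax' : ∀ T ⊆ free A, G.IsIndepSet (T : Set (Fin m)) →
        val (weights v) i T ≤ val (weights v) i (S ∩ free A) := by
      intro T hT hTi
      have h₁ := hmax T hTi
      rw [← Finset.sum_filter, ← Finset.sum_filter, Finset.filter_mem_eq_inter,
        Finset.filter_mem_eq_inter, Finset.inter_eq_left.2 hT] at h₁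
      have h₂ : ((val (weights v) i T : ℕ) : ℚ≥0) ≤ (val (weights v) i (S ∩ free A) : ℕ) := by
        simp only [val, ← scaledVal_eq_sum, scaledVal_fracRow]
        gcongr
      exact_mod_cast h₂
    rw [Agent.step, hfirst, free_agents, Mask.inter_ofSet]
    by_cases hw : 8 * val (weights v) i (S ∩ free A) < θ i
    · rw [if_pos ((wants_iff i _ _ _).2 hw)]
      refine ⟨Function.update θ i (θ i / 2), fun _ => ∅, ?_, h.restart hi fun T hT hTi =>
        lt_of_le_of_lt (Nat.mul_le_mul_left 8 (hmax' T hT hTi)) hw, measure_restart hi, fun k => ?_⟩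
      · rw [Agent.restart, agents, hupd, agents_update_threshold, Nat.div2_val, agents,
          List.map_ofFn, agents]
        congr 1
        funext k
        simp only [Function.comp_apply, Mask.map_false_ofSet]
      · by_cases hk : k = i
        · subst hk; simp [Nat.div_le_self]
        · simp [hk]
    · rw [if_neg (mt (wants_iff i _ _ _).1 hw)]
      obtain ⟨S', hsub, heq, hex, hmin⟩ := shrink_agents (v := v) (θ := θ) (A := A)
        (S ∩ free A) ⟨i, hi, not_lt.1 hw⟩
      obtain ⟨k, hk, -, hupd'⟩ := List.exists_find?_updateFirst_ofFn
        (fun i => ((fracRow (v i), θ i, Mask.ofSet (A i)) : Agent)) (Agent.happy (Mask.ofSet S'))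
        (hex.imp fun i hi => (happy_iff i S').2 hi)
      rw [happy_iff] at hk
      refine ⟨θ, Function.update A k S', ?_, h.assign (hsub.trans Finset.inter_subset_right)
        (hS.mono ?_) hk.1 hk.2 hmin, measure_assign hk.1 hk.2, fun _ => le_rfl⟩
      · rw [heq, Agent.assign, agents, hupd', agents_update_bundle]
      · exact_mod_cast hsub.trans Finset.inter_subset_left

/-! ### Completing the allocation -/

/-- If every bundle contained a neighbour of an unplaced item, disjointness would give that item `n`
distinct neighbours, more than the maximum degree allows. -/
theorem complete_spec (G : SimpleGraph (Fin m)) [DecidableRel G.Adj] (hn : G.maxDegree < n)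
    (hd : ∀ j i i', j ∈ A i → j ∈ A i' → i = i')
    (hind : ∀ i, G.IsIndepSet (A i : Set (Fin m))) :
    ∃ A' : Fin n → Finset (Fin m), (∀ i, A i ⊆ A' i) ∧ Feasible G A' ∧
      complete (List.ofFn fun j => Mask.ofSet (G.neighborFinset j))
        (List.ofFn fun i => Mask.ofSet (A i)) = List.ofFn fun i => Mask.ofSet (A' i) := by
  classical
  have key : ∀ (L : List (Fin m)) (A : Fin n → Finset (Fin m)),
      (∀ j i i', j ∈ A i → j ∈ A i' → i = i') →
      (∀ i, G.IsIndepSet (A i : Set (Fin m))) →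
      ∃ A' : Fin n → Finset (Fin m), (∀ i, A i ⊆ A' i) ∧
        (∀ j i i', j ∈ A' i → j ∈ A' i' → i = i') ∧
        (∀ i, G.IsIndepSet (A' i : Set (Fin m))) ∧ (∀ j ∈ L, ∃ i, j ∈ A' i) ∧
        (L.map fun j => (Mask.ofSet {j}, Mask.ofSet (G.neighborFinset j))).foldl (fun l x =>
          if (l.any fun B => Mask.overlap B x.1) = true then l
          else l.updateFirst (fun B => !Mask.overlap B x.2) fun B => Mask.union B x.1)
          (List.ofFn fun i => Mask.ofSet (A i)) = List.ofFn fun i => Mask.ofSet (A' i) := by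
    intro L
    induction L with
    | nil => exact fun A hd hind => ⟨A, fun _ => subset_rfl, hd, hind, by simp, rfl⟩
    | cons a L ih =>
      intro A hd hind
      rw [List.map_cons, List.foldl_cons]
      by_cases ha : ∃ i, a ∈ A i
      · rw [if_pos (by rw [List.any_ofFn]; simpa [Mask.overlap_ofSet] using ha)]
        obtain ⟨A', hsub, hd', hind', hcov, heq⟩ := ih A hd hind
        refine ⟨A', hsub, hd', hind', fun j hj => ?_, heq⟩
        rcases List.mem_cons.1 hj with rfl | hj
        · exact ha.imp fun i hi => hsub i hi
        · exact hcov j hj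
      · rw [if_neg (by rw [List.any_ofFn]; simpa [Mask.overlap_ofSet] using ha)]
        have hex : ∃ i, ∀ j ∈ A i, ¬ G.Adj a j := by
          by_contra! hcon
          choose f hf hadj using hcon
          have hinj : Function.Injective f := fun i i' hii =>
            hd (f i) i i' (hf i) (hii ▸ hf i')
          have h₁ : Finset.univ.image f ⊆ G.neighborFinset a := by
            intro j hj
            obtain ⟨i, -, rfl⟩ := Finset.mem_image.1 hj
            simpa using hadj i
          have h₂ := Finset.card_le_card h₁
          rw [Finset.card_image_of_injective _ hinj, Finset.card_univ, Fintype.card_fin,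
            SimpleGraph.card_neighborFinset_eq_degree] at h₂
          have := G.degree_le_maxDegree a
          omega
        obtain ⟨i, hi, -, hupd⟩ := List.exists_find?_updateFirst_ofFn
          (fun i => Mask.ofSet (A i)) (fun B => !Mask.overlap B (Mask.ofSet (G.neighborFinset a)))
          (hex.imp fun i hi => by
            rw [Bool.not_eq_true', ← Bool.not_eq_true, Mask.overlap_ofSet]
            simpa using hi)
        rw [Bool.not_eq_true', ← Bool.not_eq_true, Mask.overlap_ofSet] at hi
        replace hi : ∀ j ∈ A i, ¬ G.Adj a j := by simpa using hi
        have hupd' : List.ofFn (Function.update (fun i => Mask.ofSet (A i)) i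
            (Mask.union (Mask.ofSet (A i)) (Mask.ofSet {a}))) =
            List.ofFn fun k => Mask.ofSet (Function.update A i (A i ∪ {a}) k) := by
          congr 1
          funext k
          by_cases hk : k = i
          · subst hk; simp [Mask.union_ofSet]
          · simp [hk]
        rw [hupd, hupd']
        push Not at ha
        have hmem : ∀ k j, j ∈ Function.update A i (A i ∪ {a}) k ↔ j ∈ A k ∨ (k = i ∧ j = a) := by
          intro k j
          by_cases hk : k = i
          · subst hk; simp [or_comm]
          · simp [hk]
        obtain ⟨A', hsub, hd', hind', hcov, heq⟩ := ih (Function.update A i (A i ∪ {a}))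
          (by
            intro j k k' hk hk'
            rw [hmem] at hk hk'
            rcases hk with hk | ⟨rfl, rfl⟩ <;> rcases hk' with hk' | ⟨rfl, hk'⟩
            · exact hd j k k' hk hk'
            · exact absurd (hk' ▸ hk) (ha k)
            · exact absurd hk' (ha k')
            · rfl)
          (by
            intro k x hx y hy hxy hadj
            rw [Finset.mem_coe, hmem] at hx hy
            rcases hx with hx | ⟨rfl, rfl⟩ <;> rcases hy with hy | ⟨h', h''⟩
            · exact hind k hx hy hxy hadj
            · subst h' h''
              exact hi x hx hadj.symm
            · exact hi y hy hadj
            · exact hxy h''.symm)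
        refine ⟨A', fun k j hj => hsub k ((hmem k j).2 (.inl hj)), hd', hind', fun j hj => ?_, heq⟩
        rcases List.mem_cons.1 hj with rfl | hj
        · exact ⟨i, hsub i ((hmem i j).2 (.inr ⟨rfl, rfl⟩))⟩
        · exact hcov j hj
  obtain ⟨A', hsub, hd', hind', hcov, heq⟩ := key (List.finRange m) A hd hind
  refine ⟨A', hsub, ⟨fun j => ?_, hind'⟩, ?_⟩
  · obtain ⟨i, hi⟩ := hcov j (List.mem_finRange j)
    exact ⟨i, hi, fun i' hi' => hd' j i' i hi' hi⟩
  · rw [complete, List.length_ofFn, Mask.singletons_eq, List.zip_ofFn_ofFn,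
      List.ofFn_eq_map (f := fun j : Fin m => (_, _)), heq]

end BagFilling

/-! ### Running time of the main loop -/

/-- A loop whose number of iterations is bounded by a decreasing measure, and in which the sizes
of the states are controlled by a nonincreasing quantity. -/
theorem Comp.while {σ : Type*} {e : σ → Data} {c : σ → Bool} {f : σ → σ} {μ b : σ → ℕ}
    (hc : Comp e fun s => .ofBool (c s))
    (hf : Comp (fun s : {s // c s = true} => e s) fun s => e (f s))
    (hμ : ∀ s, c s = true → μ (f s) < μ s) (hb : ∀ s, c s = true → b (f s) ≤ b s)
    (hμe : PolyBound (fun s => (e s).size) μ) (heb : PolyBound b fun s => (e s).size)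
    (hbe : PolyBound (fun s => (e s).size) b) :
    ∃ g : σ → σ, Comp e (fun s => e (g s)) ∧ ∀ s, c (g s) = false ∧ ∃ k, g s = f^[k] s := by
  classical
  have hex : ∀ s, ∃ k ≤ μ s, c (f^[k] s) = false := by
    intro s
    by_contra! hcon
    have : ∀ k ≤ μ s + 1, μ (f^[k] s) + k ≤ μ s := by
      intro k
      induction k with
      | zero => simp
      | succ k ih =>
        intro hk
        have h₁ := hμ _ (by simpa using hcon k (by omega))
        have h₂ := ih (by omega)
        rw [Function.iterate_succ_apply']
        omega
    have := this (μ s + 1) le_rfl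
    omega
  have hex' : ∀ s, ∃ k, c (f^[k] s) = false := fun s => (hex s).imp fun _ h => h.2
  let N : σ → ℕ := fun s => Nat.find (hex' s)
  have hN : ∀ s, N s ≤ μ s := fun s => by
    obtain ⟨k, hk, hk'⟩ := hex s
    exact (Nat.find_min' (hex' s) hk').trans hk
  have hlt : ∀ s k, k < N s → c (f^[k] s) = true := fun s k hk => by
    simpa using Nat.find_min (hex' s) hk
  have hdec : ∀ s k, k ≤ N s → b (f^[k] s) ≤ b s := by
    intro s k
    induction k with
    | zero => simp
    | succ k ih =>
      intro hk
      rw [Function.iterate_succ_apply']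
      exact (hb _ (hlt s k hk)).trans (ih (by omega))
  refine ⟨fun s => f^[N s] s, ?_, fun s => ⟨Nat.find_spec (hex' s), N s, rfl⟩⟩
  refine Comp.loop (s := fun s k => e (f^[k] s)) (N := N) ?_ ?_ (hμe.of_le hN) ?_
  · convert hc.reindex fun j : {j : σ × ℕ // j.2 ≤ N j.1} => f^[j.1.2] j.1.1 using 3 with j
    by_cases h : j.1.2 < N j.1.1
    · simp [h, hlt _ _ h]
    · have : j.1.2 = N j.1.1 := by have := j.2; omega
      rw [this]
      simpa using (Nat.find_spec (hex' j.1.1)).symm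
  · convert hf.reindex fun j : {j : σ × ℕ // j.2 < N j.1} =>
      (⟨f^[j.1.2] j.1.1, hlt _ _ j.2⟩ : {s // c s = true}) using 3 with j
    exact Function.iterate_succ_apply' f _ _
  -- The size of a later state is polynomial in its own `b`, hence in the initial `b`, hence in the
  -- initial size; polynomials are not iterated along the loop.
  · have h₁ := hbe.reindex fun j : {j : σ × ℕ // j.2 ≤ N j.1} => j.1.1
    have h₂ := heb.reindex fun j : {j : σ × ℕ // j.2 ≤ N j.1} => f^[j.1.2] j.1.1
    exact h₁.trans (h₂.mono fun j => hdec _ _ j.2)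

theorem Enc.esize_ofFn {α : Type*} [Enc α] {k : ℕ} (f : Fin k → α) :
    esize (List.ofFn f) = ∑ i, (esize (f i) + 1) + 1 := by
  induction k with
  | zero => simp [esize_nil]
  | succ k ih =>
    rw [List.ofFn_succ, esize_cons, ih, Fin.sum_univ_succ]
    omega

theorem Enc.enc_ofFn {α : Type*} [Enc α] {k : ℕ} (f : Fin k → α) :
    enc (List.ofFn f) = .ofVector fun i => enc (f i) := by
  change Data.ofList ((List.ofFn f).map enc) = _
  rw [List.map_ofFn]
  rfl

theorem Enc.enc_ofSet {k : ℕ} (S : Finset (Fin k)) : enc (Mask.ofSet S) = .ofFinset S := by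
  rw [Mask.ofSet, enc_ofFn, Data.ofFinset]
  congr 1

theorem Enc.enc_fracRow {k : ℕ} (v : Fin k → ℚ≥0) :
    enc (fracRow v) = .ofVector fun j => .ofNNRat (v j) := by
  rw [fracRow, enc_ofFn]
  rfl

open Classical in
/-- The adjacency matrix of a graph as a list of masks. -/
def adjRows {k : ℕ} (G : SimpleGraph (Fin k)) : List (List Bool) :=
  List.ofFn fun j => Mask.ofSet (G.neighborFinset j)

theorem length_adjRows {k : ℕ} (G : SimpleGraph (Fin k)) : (adjRows G).length = k := by
  simp [adjRows]

theorem Enc.enc_adjRows {k : ℕ} (G : SimpleGraph (Fin k)) : enc (adjRows G) = .ofGraph G := by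
  rw [adjRows, enc_ofFn, Data.ofGraph]
  congr 1
  funext i
  rw [enc_ofSet, Data.ofFinset]
  congr 1
  funext j
  congr 1
  simp

namespace BagFilling

/-- A state of the main loop, for an instance in `D`. -/
structure State (D : Set ConflictInstance) where
  inst : ConflictInstance
  mem : inst ∈ D
  θ : Fin inst.n → ℕ
  bundle : Fin inst.n → Finset (Fin inst.m)
  inv : Inv inst.graph (weights inst.val) θ bundle

namespace State

variable {D : Set ConflictInstance}

/-- The data that represent a state. -/
def raw (s : State D) : List (List Bool) × List Agent :=
  (adjRows s.inst.graph, agents s.inst.val s.θ s.bundle)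

def unsat (s : State D) : Bool := (agents s.inst.val s.θ s.bundle).any Agent.unsat

def potential (s : State D) : ℕ := measure (weights s.inst.val) s.θ s.bundle

/-- A quantity that is equivalent to the size of the state and does not grow. -/
def capacity (s : State D) : ℕ :=
  esize (adjRows s.inst.graph) +
    -- The term `s.inst.m` stands for the mask of a bundle, whose size is of that order for every
    -- bundle.
    ∑ i, (esize (fracRow (s.inst.val i)) + (s.θ i).size + s.inst.m + 1)

theorem esize_raw (s : State D) : esize s.raw = esize (adjRows s.inst.graph) +
    (∑ i, (esize (fracRow (s.inst.val i)) + (esize (s.θ i) +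
      esize (Mask.ofSet (s.bundle i)) + 1) + 1 + 1) + 1) + 1 := by
  rw [raw, esize_pair, agents, esize_ofFn]
  rfl

theorem capacity_le (s : State D) : s.capacity ≤ esize s.raw := by
  rw [esize_raw, capacity, add_assoc, add_assoc]
  refine Nat.add_le_add_left ((Finset.sum_le_sum fun i _ => ?_).trans (Nat.le_add_right _ _)) _
  have h₁ := Nat.size_le_esize (s.θ i)
  have h₂ := length_le_esize (Mask.ofSet (s.bundle i))
  simp only [Mask.ofSet, List.length_ofFn] at *
  omega

theorem esize_raw_le (s : State D) : esize s.raw ≤ 10 * s.capacity + 2 := by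
  rw [esize_raw, capacity, mul_add, Finset.mul_sum]
  have : ∑ i, (esize (fracRow (s.inst.val i)) + (esize (s.θ i) +
      esize (Mask.ofSet (s.bundle i)) + 1) + 1 + 1) ≤
      ∑ i, 10 * (esize (fracRow (s.inst.val i)) + (s.θ i).size + s.inst.m + 1) := by
    refine Finset.sum_le_sum fun i _ => ?_
    have h₁ := esize_nat_le (s.θ i)
    have h₂ := esize_mask_le (Mask.ofSet (s.bundle i))
    simp only [Mask.ofSet, List.length_ofFn] at *
    omega
  omega

theorem potential_le (s : State D) :
    s.potential ≤ (esize s.raw + 1) * esize s.raw + esize s.raw := by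
  classical
  have hn : s.inst.n ≤ s.capacity := by
    refine le_trans ?_ (Nat.le_add_left _ _)
    calc s.inst.n = ∑ _i : Fin s.inst.n, 1 := by simp
      _ ≤ _ := Finset.sum_le_sum fun i _ => by omega
  have hθ : ∑ i, (s.θ i).size ≤ s.capacity := by
    refine le_trans ?_ (Nat.le_add_left _ _)
    exact Finset.sum_le_sum fun i _ => by omega
  have hc := s.capacity_le
  unfold potential measure
  refine Nat.add_le_add (Nat.mul_le_mul (by omega) (by omega)) ?_
  refine (Finset.card_le_univ _).trans ?_
  rw [Fintype.card_fin]
  omega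

end State

/-- The initial state. -/
def initial {D : Set ConflictInstance} (I : D) : State D where
  inst := I.1
  mem := I.2
  θ i := val (weights I.1.val) i Finset.univ
  bundle _ := ∅
  inv := inv_empty fun i _ _ => ⟨i, Finset.sum_le_sum_of_subset (Finset.subset_univ _)⟩

theorem comp_initial (D : Set ConflictInstance) :
    Comp (fun I : D => I.1.encode) fun I => enc (initial I).raw := by
  have h : PT fun x : List (List Bool) × List (List (ℕ × ℕ)) =>
      ((x.1, x.2.map fun r => (r, scaledVal r (x.1.map fun _ => true), x.1.map fun _ => false)) :
        List (List Bool) × List Agent) := by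
    refine PT.prodMk (by fun_prop) (PT.map
      (g := fun (x : List (List Bool) × List (List (ℕ × ℕ))) r =>
        ((r, scaledVal r (x.1.map fun _ => true), x.1.map fun _ => false) : Agent))
      (by fun_prop) (by fun_prop))
  convert Comp.reindex h fun I : D =>
    (adjRows I.1.graph, List.ofFn fun i => fracRow (I.1.val i)) using 2 with I I
  · rw [enc_pair, enc_adjRows, enc_ofFn]
    simp only [enc_fracRow]
    rfl
  · have h₁ : ∀ b : Bool, ((adjRows I.1.graph).map fun _ => b) =
        List.ofFn fun _ : Fin I.1.m => b := fun b => by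
      rw [adjRows, List.map_ofFn]; rfl
    have h₂ : (List.ofFn fun _ : Fin I.1.m => true) = Mask.ofSet (m := I.1.m) Finset.univ := by
      simp [Mask.ofSet]
    have h₃ : (List.ofFn fun _ : Fin I.1.m => false) = Mask.ofSet (m := I.1.m) ∅ := by
      simp [Mask.ofSet]
    simp only [h₁, h₂, h₃, State.raw, initial, agents, List.map_ofFn]
    congr 2
    congr 1
    funext i
    simp [scaledVal_eq_sum]

/-- The iteration step can be carried out in polynomial time, with the help of a solver for the
maximum weighted independent set problem. -/
theorem comp_step {C : GraphClass} (hC : MWISPolyTimeOn C.inducedSubgraphs)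
    {D : Set ConflictInstance} (hD : ∀ I ∈ D, ⟨I.m, I.graph⟩ ∈ C) :
    ∃ f : State D → State D,
      Comp (fun s : {s : State D // s.unsat = true} => enc s.1.raw) (fun s => enc (f s).raw) ∧
      ∀ s, (f s).inst = s.inst ∧ (s.unsat = true →
        (f s).potential < s.potential ∧ (f s).capacity ≤ s.capacity) := by
  classical
  obtain ⟨p, q, hp⟩ := hC
  let Ω := {s : State D // s.unsat = true}
  have hstep := fun s : Ω => s.1.inv.step (any_unsat_iff.1 s.2)
  choose u hu hnext using hstep
  let W : Ω → WeightedGraph := fun s => ⟨s.1.inst.m, s.1.inst.graph, u s⟩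
  -- Items that are not free get weight 0 instead of being deleted, so the solver is only called on
  -- the whole conflict graph.
  have hW : ∀ s, W s ∈ {W : WeightedGraph | ⟨W.m, W.graph⟩ ∈ C.inducedSubgraphs} := fun s =>
    ⟨s.1.inst.m, s.1.inst.graph, RelEmbedding.refl _, hD _ s.1.mem, rfl⟩
  -- Fixing one answer of the solver for each state makes the next state a function of the current
  -- one.
  have hsol := fun s => hp (W s) (hW s)
  choose y t ht htq S hS hy using hsol
  have hsolve : Comp (fun s => (W s).encode) y := ⟨p, t, ⟨q, htq⟩, ht⟩
  choose θ' A' hraw hinv hmeas hle using fun s => hnext s (S s) (hS s).1 (hS s).2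
  let next : Ω → State D := fun s => ⟨s.1.inst, s.1.mem, θ' s, A' s, hinv s⟩
  refine ⟨fun s => if h : s.unsat = true then next ⟨s, h⟩ else s, ?_,
    fun s => ⟨?_, fun hs => ?_⟩⟩
  · have hq : Comp (fun s : Ω => enc s.1.raw) fun s => (W s).encode := by
      have h : PT fun x : List (List Bool) × List Agent => (x.1, Agent.query x.1.length x.2) := by
        fun_prop
      convert Comp.reindex h fun s : Ω => s.1.raw using 2 with s
      simp only [State.raw, length_adjRows]
      rw [hu, enc_pair, enc_adjRows, enc_fracRow]
      rfl
    have hans := Comp.id.cons (hq.trans hsolve)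
    have h : PT fun x : (List (List Bool) × List Agent) × List Bool =>
        (x.1.1, Agent.step x.1.1.length x.1.2 x.2) := by
      fun_prop
    have h' := Comp.reindex h fun s : Ω => (s.1.raw, Mask.ofSet (S s))
    have hy' : ∀ s : Ω, enc (s.1.raw, Mask.ofSet (S s)) = .cons (enc s.1.raw) (y s) := fun s => by
      rw [enc_pair, enc_ofSet, hy]
    simp only [hy'] at h'
    convert hans.trans h' using 2 with s
    beta_reduce
    rw [dif_pos s.2]
    simp only [State.raw, length_adjRows, next]
    rw [hraw]
  · beta_reduce
    split <;> rfl
  · beta_reduce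
    rw [dif_pos hs]
    refine ⟨hmeas ⟨s, hs⟩, Nat.add_le_add_left (Finset.sum_le_sum fun i _ => ?_) _⟩
    have : (θ' ⟨s, hs⟩ i).size ≤ (s.θ i).size := Nat.size_le_size (hle ⟨s, hs⟩ i)
    change esize (fracRow (s.inst.val i)) + (θ' ⟨s, hs⟩ i).size + s.inst.m + 1 ≤ _
    omega

/-- The main loop. -/
theorem comp_fill {C : GraphClass} (hC : MWISPolyTimeOn C.inducedSubgraphs)
    {D : Set ConflictInstance} (hD : ∀ I ∈ D, ⟨I.m, I.graph⟩ ∈ C) :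
    ∃ g : State D → State D, Comp (fun s : State D => enc s.raw) (fun s => enc (g s).raw) ∧
      ∀ s, (g s).unsat = false ∧ (g s).inst = s.inst := by
  obtain ⟨f, hf, hf'⟩ := comp_step hC hD
  have hc : Comp (fun s : State D => enc s.raw) fun s => .ofBool s.unsat := by
    have h : PT fun x : List (List Bool) × List Agent => x.2.any Agent.unsat := by
      exact PT.any (p := fun _ => Agent.unsat) (by fun_prop) (by fun_prop)
    exact Comp.reindex h State.raw
  obtain ⟨g, hg, hg'⟩ := Comp.while (f := f) (μ := State.potential) (b := State.capacity) hc hf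
    (fun s hs => ((hf' s).2 hs).1) (fun s hs => ((hf' s).2 hs).2)
    ((((PolyBound.self.add (.const 1)).mul .self).add .self).of_le State.potential_le)
    ((((PolyBound.const 10).mul .self).add (.const 2)).of_le State.esize_raw_le)
    (PolyBound.self.of_le State.capacity_le)
  refine ⟨g, hg, fun s => ⟨(hg' s).1, ?_⟩⟩
  obtain ⟨k, hk⟩ := (hg' s).2
  rw [hk]
  clear hk
  induction k with
  | zero => rfl
  | succ k ih => rw [Function.iterate_succ_apply', (hf' _).1, ih]

/-- Completing the bundles of a final state gives an approximate maximin share allocation. -/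
theorem State.exists_isApproxMMS {D : Set ConflictInstance} (s : State D)
    (hD : s.inst.maxDegree < s.inst.n) (hs : s.unsat = false) :
    ∃ A : Fin s.inst.n → Finset (Fin s.inst.m), s.inst.IsApproxMMS (1 / 8) A ∧
      enc (complete s.raw.1 (s.raw.2.map fun a => a.2.2)) = s.inst.encodeAllocation A := by
  classical
  obtain ⟨A, hsub, hfeas, heq⟩ := complete_spec s.inst.graph hD s.inv.disjoint s.inv.indep
  refine ⟨A, ⟨hfeas, fun i => ?_⟩, ?_⟩
  · have hsat : s.θ i ≤ 8 * val (weights s.inst.val) i (s.bundle i) := by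
      by_contra hlt
      have := any_unsat_iff.2 ⟨i, show Unsat (weights s.inst.val) s.θ s.bundle i from
        not_le.1 hlt⟩
      rw [State.unsat] at hs
      rw [hs] at this
      simp at this
    have hmono : s.inst.value i (s.bundle i) ≤ s.inst.value i (A i) :=
      Finset.sum_le_sum_of_subset (hsub i)
    have key : ∀ Q, s.inst.IsFeasible Q →
        ∃ k, s.inst.value i (Q k) ≤ 8 * s.inst.value i (A i) := by
      intro Q hQ
      obtain ⟨k, hk⟩ := s.inv.share_le i Q hQ
      refine ⟨k, ?_⟩
      have h₁ := hk.trans hsat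
      have h₂ : ((val (weights s.inst.val) i (Q k) : ℕ) : ℚ≥0) ≤
          ((8 * val (weights s.inst.val) i (s.bundle i) : ℕ) : ℚ≥0) := by exact_mod_cast h₁
      rw [Nat.cast_mul] at h₂
      simp only [val, weights, ← scaledVal_eq_sum, scaledVal_fracRow] at h₂
      rw [mul_left_comm] at h₂
      have h₃ : (0 : ℚ≥0) < denProd (s.inst.val i) := by exact_mod_cast denProd_pos _
      have h₄ := le_of_mul_le_mul_left h₂ h₃
      exact h₄.trans (mul_le_mul_of_nonneg_left hmono (by simp))
    have hmms : s.inst.mms i ≤ 8 * (s.inst.value i (A i) : ℝ) := by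
      refine Real.iSup_le (fun Q => ?_) (by positivity)
      obtain ⟨k, hk⟩ := key Q.1 Q.2
      refine (ciInf_le (Set.finite_range _).bddBelow k).trans ?_
      exact_mod_cast hk
    linarith
  · have h₁ : (s.raw.2.map fun a => a.2.2) = List.ofFn fun i => Mask.ofSet (s.bundle i) := by
      rw [State.raw, agents, List.map_ofFn]
      rfl
    have h₂ : complete s.raw.1 (s.raw.2.map fun a => a.2.2) =
        List.ofFn fun i => Mask.ofSet (A i) := by
      rw [h₁]
      exact heq
    rw [h₂, enc_ofFn, ConflictInstance.encodeAllocation]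
    simp only [enc_ofSet]

end BagFilling

/-! ### The main theorem -/

theorem mainTheorem12 (C : GraphClass) (hC : MWISPolyTimeOn C.inducedSubgraphs) :
    PolyTimeSolvableOn
      {I : ConflictInstance | ⟨I.m, I.graph⟩ ∈ C ∧ I.maxDegree < I.n}
      ConflictInstance.encode
      (fun I y => ∃ A : Fin I.n → Finset (Fin I.m),
        I.IsApproxMMS (1 / 8) A ∧ y = I.encodeAllocation A) := by
  obtain ⟨g, hg, hg'⟩ := BagFilling.comp_fill hC
    (D := {I : ConflictInstance | ⟨I.m, I.graph⟩ ∈ C ∧ I.maxDegree < I.n}) fun I hI => hI.1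
  have hout : PT fun x : List (List Bool) × List Agent =>
      complete x.1 (x.2.map fun a => a.2.2) := PT.complete_comp (by fun_prop) (by fun_prop)
  obtain ⟨p, t, ⟨q, hq⟩, hp⟩ := ((BagFilling.comp_initial _).trans
    (hg.reindex BagFilling.initial)).trans
    (Comp.reindex hout fun I => (g (BagFilling.initial I)).raw)
  refine ⟨p, q, fun I hI => ⟨_, t ⟨I, hI⟩, hp ⟨I, hI⟩, hq ⟨I, hI⟩, ?_⟩⟩
  obtain ⟨hs, hinst⟩ := hg' (BagFilling.initial ⟨I, hI⟩)
  have key := (g (BagFilling.initial ⟨I, hI⟩)).exists_isApproxMMS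
    (g (BagFilling.initial ⟨I, hI⟩)).mem.2 hs
  change ∃ A : Fin I.n → Finset (Fin I.m), I.IsApproxMMS (1 / 8) A ∧
    enc (complete (g (BagFilling.initial ⟨I, hI⟩)).raw.1
      ((g (BagFilling.initial ⟨I, hI⟩)).raw.2.map fun a => a.2.2)) = I.encodeAllocation A
  -- With the output abstracted, `key` depends on the final state only through its instance, which
  -- `hinst` identifies with `I`.
  generalize enc (complete (g (BagFilling.initial ⟨I, hI⟩)).raw.1 _) = y at key ⊢
  rw [hinst] at key
  exact key

end
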